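/- All graphs are finite and simple. A graph is called an odd-cycle graph if it has no cycle of even length. For a graph $G$ with $n\ge 1$ vertices let $m_k(G)$ be the number of sets of $k$ pairwise vertex-disjoint edges of $G$ (so $m_0(G)=1$), let $$m(G,x)=\sum_{k=0}^{\lfloor n/2\rfloor}(-1)^k m_k(G)\,x^{n-2k}$$ be its matching polynomial, and let $t(G)$ be the largest real root of $m(G,x)$. For an orientation $\sigma$ of $G$ let $S(G^\sigma)=[s_{uv}]$ be the skew-adjacency matrix, where $s_{uv}=1$ and $s_{vu}=-1$ if $u\to v$ is an arc, and $s_{uv}=0$ if $u,v$ are not adjacent. Let $\rho(G^\sigma)$ be the largest modulus of a complex eigenvalue of $S(G^\sigma)$, and let $\rho_s(G)=\max_\sigma\rho(G^\sigma)$, the maximum being over all orientations $\sigma$ of $G$. **Theorem.** Let $n\ge 1$. Up to isomorphism there is exactly one odd-cycle graph $H_n$ of order $n$ that has a vertex of degree $n-1$ and exactly $\lfloor 3(n-1)/2\rfloor$ edges. For every odd-cycle graph $G$ of order $n$, the largest real root $t(G)$ exists, and $$t(G)\le t(H_n),\qquad\text{with equality if and only if } G\cong H_n .$$ Moreover $\rho(G^\sigma)=t(G)$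 for every orientation $\sigma$ of $G$; hence $\rho_s(G)=t(G)$, and $$\rho_s(G)\le\rho_s(H_n),\qquad\text{with equality if and only if } G\cong H_n ,$$ which is the conjecture of Cavers et al. -/

import Mathlib

open Polynomial

namespace SimpleGraph

/-- An odd-cycle graph: a simple graph with no even cycle, i.e. every cycle has odd length. -/
def IsOddCycleGraph {V : Type*} (G : SimpleGraph V) : Prop :=
  ∀ (v : V) (c : G.Walk v v), c.IsCycle → Odd c.length

open Classical in
/-- The sets of `k` independent (pairwise vertex-disjoint) edges of `G`. -/
noncomputable def matchings {V : Type*} [Fintype V] (G : SimpleGraph V) (k : ℕ) :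
    Finset (Finset (Sym2 V)) :=
  {M ∈ G.edgeFinset.powersetCard k | ∀ e ∈ M, ∀ f ∈ M, e ≠ f → ∀ v : V, v ∈ e → v ∉ f}

/-- The matching polynomial `∑ₖ (-1)ᵏ mₖ(G) xⁿ⁻²ᵏ`, where `n` is the number of vertices and `mₖ(G)`
is the number of sets of `k` independent edges; `mₖ(G) = 0` when `2k > n`, so the sum runs over
`k ≤ n / 2`. -/
noncomputable def matchingPoly {V : Type*} [Fintype V] (G : SimpleGraph V) : ℝ[X] :=
  ∑ k ∈ Finset.range (Fintype.card V / 2 + 1),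
    C ((-1 : ℝ) ^ k * ((G.matchings k).card : ℝ)) * X ^ (Fintype.card V - 2 * k)

/-- The maximum matching root `t(G)`: the largest real root of the matching polynomial. -/
noncomputable def maxMatchingRoot {V : Type*} [Fintype V] (G : SimpleGraph V) : ℝ :=
  sSup {x : ℝ | G.matchingPoly.IsRoot x}

/-- An orientation of `G`: for every edge `uv` exactly one of the arcs `u → v`, `v → u` is chosen,
and there are no other arcs. -/
structure EdgeOrientation {V : Type*} (G : SimpleGraph V) where
  /-- `arc u v` means `u → v`. -/
  arc : V → V → Prop
  adj_iff : ∀ u v, G.Adj u v ↔ arc u v ∨ arc v u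
  asymm : ∀ u v, arc u v → ¬ arc v u

open Classical in
/-- The skew-adjacency matrix of the oriented graph, with complex entries. -/
noncomputable def EdgeOrientation.skewMatrix {V : Type*} {G : SimpleGraph V}
    (σ : G.EdgeOrientation) : Matrix V V ℂ :=
  Matrix.of fun u v => if σ.arc u v then 1 else if σ.arc v u then -1 else 0

open Classical in
/-- The spectral radius of the oriented graph: the largest modulus of an eigenvalue of its
skew-adjacency matrix. -/
noncomputable def EdgeOrientation.radius {V : Type*} [Fintype V] {G : SimpleGraph V}
    (σ : G.EdgeOrientation) : ℝ :=
  (spectralRadius ℂ σ.skewMatrix).toReal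

/-- The maximum skew-spectral radius of `G`: the maximum, over the finitely many orientations
of `G`, of the spectral radius. -/
noncomputable def maxSkewRadius {V : Type*} [Fintype V] (G : SimpleGraph V) : ℝ :=
  ⨆ σ : G.EdgeOrientation, σ.radius

open Classical in
/-- The property that defines `Hₙ` (up to isomorphism), where `n ≥ 1` is the number of vertices:
an odd-cycle graph with a vertex of degree `n - 1` and with `⌊3(n - 1)/2⌋` edges. -/
structure IsExtremalOddCycleGraph {V : Type*} [Fintype V] (G : SimpleGraph V) : Prop where
  isOddCycleGraph : G.IsOddCycleGraph
  exists_degree : ∃ v, G.degree v = Fintype.card V - 1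
  card_edges : G.edgeFinset.card = 3 * (Fintype.card V - 1) / 2

end SimpleGraph

/-! Put `y = x ^ 2` and let `L(T)` be the sum of `(-1 / y) ^ |M|` over the matchings `M` inside a
vertex set `T`. For `x ≠ 0`, the matching polynomial is `x ^ n * L(V)` (`eval_matchingPoly`), so its
nonzero roots are governed by the zeros of `L(V)`. Deleting a vertex `v` gives `L(V) = L(V - v) - N
/ y`, where `N` is the sum of `L(V - v - u)` over the neighbours `u` of `v`. The core is the upper
bound `y / (y - 1) * w(|T|) * L(T)` for the sum of `L(T - u)` over the neighbours `u` in `T` of an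
outside vertex (`isBalanced`), valid while `w(|T|) ≤ y - 1`; here `w` is `parityWeight`. The weight
is exactly what a fan produces: each end of an isolated edge of `T` has ratio `L(T - u) / L(T) = y /
(y - 1)`, and a lone isolated vertex has ratio `1 = y / (y - 1) * (1 - 1 / y)`.

The bound is proved by induction on `T`. Since `w` is superadditive, one may pass to components. A
component contains at most two neighbours of `v`, because three would give three cycles of even
total length (`not_three_neighbors`). One neighbour is handled by `erase_le_parityWeight`. For two
neighbours `a` and `b`, the parts hanging off `a` and off `b` are disjoint, and the two ratios are
bounded by `chordBound`, whose sum is controlled by `chordBound_add_le`.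

Hence `L(V) > 0` as long as `w(n - 1) < y - 1`, and at the critical `y₀` with `w(n - 1) = y₀ - 1` it
vanishes exactly when the bound is tight. Below the critical weight, tightness forces components of
at most two vertices, all joined to `v`, with at most one of odd size. At the critical weight some
strict inequalities degenerate; choosing `v` of maximum degree repairs this
(`isFanOver_of_max_degree`). The graphs found this way are the windmills, which are unique up to
isomorphism.

For the spectral part, `zI - iS` has determinant equal to the matching polynomial at `z`: reversing
a cycle of length at least three in the Leibniz expansion changes the sign of the term, because
cycles of `G` are odd, so only involutions, that is, matchings, survive. As `iS` is Hermitian, its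
eigenvalues are the real roots, and these are symmetric about zero. -/

namespace SimpleGraph

/-! ### Matchings inside a vertex set and their generating function. -/

variable {V : Type*} {G : SimpleGraph V}

/-- A set of pairwise vertex-disjoint edges of `G`. -/
def IsMatchingSet (G : SimpleGraph V) (M : Finset (Sym2 V)) : Prop :=
  (∀ e ∈ M, e ∈ G.edgeSet) ∧ ∀ e ∈ M, ∀ f ∈ M, ∀ v, v ∈ e → v ∈ f → e = f

theorem IsMatchingSet.subset {M N : Finset (Sym2 V)} (h : G.IsMatchingSet M) (hN : N ⊆ M) :
    G.IsMatchingSet N :=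
  ⟨fun e he => h.1 e (hN he), fun e he f hf => h.2 e (hN he) f (hN hf)⟩

open Classical in
/-- The matchings of `G` all of whose edges lie inside `S`. -/
noncomputable def matchingsWithin [Fintype V] (G : SimpleGraph V) (S : Finset V) :
    Finset (Finset (Sym2 V)) :=
  {M | G.IsMatchingSet M ∧ ∀ e ∈ M, ∀ v ∈ e, v ∈ S}

/-- The generating function of the matchings of `G` inside `S`, by number of edges. -/
noncomputable def matchingSum [Fintype V] {R : Type*} [CommRing R] (G : SimpleGraph V) (c : R)
    (S : Finset V) : R :=
  ∑ M ∈ G.matchingsWithin S, c ^ M.card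

section

variable [Fintype V]

theorem mem_matchingsWithin {S : Finset V} {M : Finset (Sym2 V)} :
    M ∈ G.matchingsWithin S ↔ G.IsMatchingSet M ∧ ∀ e ∈ M, ∀ v ∈ e, v ∈ S := by
  simp [matchingsWithin]

theorem mem_matchings {k : ℕ} {M : Finset (Sym2 V)} :
    M ∈ G.matchings k ↔ G.IsMatchingSet M ∧ M.card = k := by
  classical
  simp only [matchings, Finset.mem_filter, Finset.mem_powersetCard, IsMatchingSet]
  constructor
  · rintro ⟨⟨h1, h2⟩, h3⟩
    refine ⟨⟨fun e he => by simpa using h1 he, fun e he f hf v hv hv' => ?_⟩, h2⟩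
    by_contra hne
    exact h3 e he f hf hne v hv hv'
  · rintro ⟨⟨h1, h2⟩, h3⟩
    exact ⟨⟨fun e he => by simpa using h1 e he, h3⟩,
      fun e he f hf hne v hv hv' => hne (h2 e he f hf v hv hv')⟩

theorem IsMatchingSet.two_mul_card_le {M : Finset (Sym2 V)} (h : G.IsMatchingSet M) :
    2 * M.card ≤ Fintype.card V := by
  classical
  have h1 : (M.biUnion fun e => e.toFinset).card = ∑ e ∈ M, e.toFinset.card := by
    apply Finset.card_biUnion
    intro e he f hf hne
    rw [Function.onFun, Finset.disjoint_left]
    intro v hv hv'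
    exact hne (h.2 e he f hf v (Sym2.mem_toFinset.1 hv) (Sym2.mem_toFinset.1 hv'))
  have h2 : ∑ e ∈ M, e.toFinset.card = ∑ e ∈ M, 2 :=
    Finset.sum_congr rfl fun e he =>
      Sym2.card_toFinset_of_not_isDiag e (G.not_isDiag_of_mem_edgeSet (h.1 e he))
  have h3 := Finset.card_le_univ (M.biUnion fun e => e.toFinset)
  rw [h1, h2, Finset.sum_const, smul_eq_mul] at h3
  lia

@[simp]
theorem matchingSum_empty {R : Type*} [CommRing R] (c : R) : G.matchingSum c ∅ = 1 := by
  have : G.matchingsWithin ∅ = {∅} := by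
    ext M
    rw [mem_matchingsWithin, Finset.mem_singleton]
    constructor
    · rintro ⟨-, h⟩
      rw [Finset.eq_empty_iff_forall_notMem]
      intro e he
      induction e with
      | h a b => exact absurd (h _ he a (by simp)) (by simp)
    · rintro rfl
      exact ⟨⟨by simp, by simp⟩, by simp⟩
  simp [matchingSum, this]

-- A matching either misses `v` or contains exactly one edge `vu`; removing this edge leaves a
-- matching that avoids both of its ends.
open Classical in
theorem matchingSum_erase {R : Type*} [CommRing R] (c : R) {S : Finset V} {v : V} (hv : v ∈ S) :
    G.matchingSum c S = G.matchingSum c (S.erase v) +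
      c * ∑ u ∈ (S.erase v) with G.Adj v u, G.matchingSum c ((S.erase v).erase u) := by
  have key : ∀ M, M ∈ G.matchingsWithin S → ∀ u, s(v, u) ∈ M → ∀ e ∈ M, e ≠ s(v, u) →
      v ∉ e ∧ u ∉ e := by
    intro M hM u hu e he hne
    rw [mem_matchingsWithin] at hM
    exact ⟨fun h => hne (hM.1.2 e he _ hu v h (by simp)),
      fun h => hne (hM.1.2 e he _ hu u h (by simp))⟩
  rw [matchingSum, ← Finset.sum_filter_not_add_sum_filter _ (fun M => ∃ u, s(v, u) ∈ M)]
  congr 1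
  · rw [matchingSum]
    apply Finset.sum_congr _ fun _ _ => rfl
    ext M
    simp only [Finset.mem_filter, mem_matchingsWithin, Finset.mem_erase, not_exists]
    constructor
    · rintro ⟨⟨h1, h2⟩, h3⟩
      refine ⟨h1, fun e he w hw => ⟨?_, h2 e he w hw⟩⟩
      rintro rfl
      obtain ⟨u, rfl⟩ := Sym2.mem_iff_exists.1 hw
      exact h3 u he
    · rintro ⟨h1, h2⟩
      exact ⟨⟨h1, fun e he w hw => (h2 e he w hw).2⟩, fun u hu => (h2 _ hu v (by simp)).1 rfl⟩
  · simp only [matchingSum, Finset.mul_sum]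
    rw [Finset.sum_sigma']
    symm
    apply Finset.sum_bij (fun p _ => insert s(v, p.1) p.2)
    · rintro ⟨u, M⟩ hp
      simp only [Finset.mem_sigma, Finset.mem_filter, Finset.mem_erase, mem_matchingsWithin] at hp ⊢
      obtain ⟨⟨⟨huv, huS⟩, hadj⟩, ⟨h1, h2⟩, h3⟩ := hp
      refine ⟨⟨⟨?_, ?_⟩, ?_⟩, u, Finset.mem_insert_self _ _⟩
      · intro e he
        rcases Finset.mem_insert.1 he with rfl | he
        · exact hadj
        · exact h1 e he
      · intro e he f hf w hwe hwf
        rcases Finset.mem_insert.1 he with rfl | he <;> rcases Finset.mem_insert.1 hf with rfl | hf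
        · rfl
        · have := h3 f hf w hwf
          rcases Sym2.mem_iff.1 hwe with rfl | rfl <;> simp at this
        · have := h3 e he w hwe
          rcases Sym2.mem_iff.1 hwf with rfl | rfl <;> simp at this
        · exact h2 e he f hf w hwe hwf
      · intro e he w hw
        rcases Finset.mem_insert.1 he with rfl | he
        · rcases Sym2.mem_iff.1 hw with rfl | rfl <;> assumption
        · exact (h3 e he w hw).2.2
    · rintro ⟨u, M⟩ hp ⟨u', M'⟩ hp' heq
      simp only [Finset.mem_sigma, Finset.mem_filter, Finset.mem_erase, mem_matchingsWithin]
        at hp hp'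
      have hM : ∀ w, s(v, w) ∉ M := fun w hw => (hp.2.2 _ hw v (by simp)).2.1 rfl
      have hM' : ∀ w, s(v, w) ∉ M' := fun w hw => (hp'.2.2 _ hw v (by simp)).2.1 rfl
      have hu : u = u' := by
        have : s(v, u) ∈ insert s(v, u') M' := heq ▸ Finset.mem_insert_self _ _
        rcases Finset.mem_insert.1 this with h | h
        · exact Sym2.congr_right.1 h
        · exact absurd h (hM' u)
      subst hu
      have : M = M' := by
        rw [← Finset.erase_insert (hM u), ← Finset.erase_insert (hM' u)]
        exact congrArg (fun N => N.erase s(v, u)) heq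
      rw [this]
    · intro M hM
      obtain ⟨hM, u, hu⟩ := Finset.mem_filter.1 hM
      have hM' := mem_matchingsWithin.1 hM
      have hadj : G.Adj v u := hM'.1.1 _ hu
      refine ⟨⟨u, M.erase s(v, u)⟩, ?_, Finset.insert_erase hu⟩
      simp only [Finset.mem_sigma, Finset.mem_filter, Finset.mem_erase, mem_matchingsWithin]
      refine ⟨⟨⟨hadj.ne', hM'.2 _ hu u (by simp)⟩, hadj⟩,
        hM'.1.subset (Finset.erase_subset _ _), fun e he w hw => ?_⟩
      have := key M hM u hu e he.2 he.1
      refine ⟨?_, ?_, hM'.2 e he.2 w hw⟩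
      · rintro rfl; exact this.2 hw
      · rintro rfl; exact this.1 hw
    · rintro ⟨u, M⟩ hp
      simp only [Finset.mem_sigma, Finset.mem_filter, Finset.mem_erase, mem_matchingsWithin] at hp
      have hM : s(v, u) ∉ M := fun hw => (hp.2.2 _ hw v (by simp)).2.1 rfl
      simp only
      rw [Finset.card_insert_of_notMem hM, pow_succ']

open Classical in
/-- The generating function is multiplicative over disjoint unions without edges in between. -/
theorem matchingSum_union {R : Type*} [CommRing R] (c : R) {S T : Finset V} (hd : Disjoint S T)
    (h : ∀ a ∈ S, ∀ b ∈ T, ¬ G.Adj a b) :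
    G.matchingSum c (S ∪ T) = G.matchingSum c S * G.matchingSum c T := by
  induction S using Finset.strongInduction with
  | H S ih =>
    rcases S.eq_empty_or_nonempty with rfl | ⟨v, hv⟩
    · simp
    have hvT : v ∉ T := Finset.disjoint_left.1 hd hv
    have hST : (S ∪ T).erase v = S.erase v ∪ T := by
      rw [Finset.erase_union_distrib, Finset.erase_eq_of_notMem hvT]
    have h1 : ∀ U ⊂ S, G.matchingSum c (U ∪ T) = G.matchingSum c U * G.matchingSum c T :=
      fun U hU => ih U hU (hd.mono_left hU.1) fun a ha => h a (hU.1 ha)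
    have hfil : ((S ∪ T).erase v).filter (G.Adj v) = (S.erase v).filter (G.Adj v) := by
      ext u
      simp only [Finset.mem_filter, Finset.mem_erase, Finset.mem_union]
      constructor
      · rintro ⟨⟨h1, h2 | h2⟩, h3⟩
        · exact ⟨⟨h1, h2⟩, h3⟩
        · exact absurd h3 (h v hv u h2)
      · rintro ⟨⟨h1, h2⟩, h3⟩
        exact ⟨⟨h1, .inl h2⟩, h3⟩
    rw [matchingSum_erase c (Finset.mem_union_left T hv), matchingSum_erase c hv, hfil, hST,
      h1 _ (Finset.erase_ssubset hv), add_mul, mul_assoc, Finset.sum_mul]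
    congr 2
    refine Finset.sum_congr rfl fun u hu => ?_
    have huS := Finset.mem_of_mem_erase (Finset.mem_filter.1 hu).1
    rw [Finset.erase_union_distrib, Finset.erase_eq_of_notMem (Finset.disjoint_left.1 hd huS)]
    exact h1 _ ((Finset.erase_subset _ _).trans_ssubset (Finset.erase_ssubset hv))

theorem sum_matchingsWithin_univ {R : Type*} [AddCommMonoid R] (f : ℕ → R) :
    ∑ M ∈ G.matchingsWithin Finset.univ, f M.card =
      ∑ k ∈ Finset.range (Fintype.card V / 2 + 1), (G.matchings k).card • f k := by
  classical
  rw [← Finset.sum_fiberwise_of_maps_to (s := G.matchingsWithin Finset.univ)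
    (t := Finset.range (Fintype.card V / 2 + 1)) (g := fun M => M.card)]
  · refine Finset.sum_congr rfl fun k _ => ?_
    have : (G.matchingsWithin Finset.univ).filter (fun M => M.card = k) = G.matchings k := by
      ext M
      simp [mem_matchingsWithin, mem_matchings]
    rw [this, ← Finset.sum_const]
    exact Finset.sum_congr rfl fun M hM => by rw [(mem_matchings.1 hM).2]
  · intro M hM
    have := (mem_matchingsWithin.1 hM).1.two_mul_card_le
    simp only [Finset.mem_range]
    lia

theorem aeval_matchingPoly {R : Type*} [CommRing R] [Algebra ℝ R] (z : R) :
    aeval z G.matchingPoly =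
      ∑ M ∈ G.matchingsWithin Finset.univ, (-1) ^ M.card * z ^ (Fintype.card V - 2 * M.card) := by
  rw [sum_matchingsWithin_univ (fun k => (-1) ^ k * z ^ (Fintype.card V - 2 * k)), matchingPoly,
    map_sum]
  refine Finset.sum_congr rfl fun k _ => ?_
  simp only [map_mul, map_pow, aeval_X, map_neg, map_one, map_natCast, nsmul_eq_mul]
  ring

/-- Factoring out the leading power turns the polynomial into a generating function in `-1 / x ^ 2`,
which is multiplicative over components and does not refer to the number of vertices. -/
theorem eval_matchingPoly {x : ℝ} (hx : x ≠ 0) :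
    G.matchingPoly.eval x =
      x ^ Fintype.card V * G.matchingSum (-1 / x ^ 2) Finset.univ := by
  have := aeval_matchingPoly (G := G) x
  rw [Polynomial.coe_aeval_eq_eval] at this
  rw [this, matchingSum, Finset.mul_sum]
  refine Finset.sum_congr rfl fun M hM => ?_
  have := (mem_matchingsWithin.1 hM).1.two_mul_card_le
  rw [pow_sub₀ _ hx this, div_pow, pow_mul]
  ring

end

end SimpleGraph

/-! ### Connectivity inside a vertex set, and what the absence of even cycles implies. -/

namespace SimpleGraph

variable {V : Type*} {G : SimpleGraph V}

/-- `b` can be reached from `a` by a walk of `G` inside `S`. -/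
def ReachableIn (G : SimpleGraph V) (S : Finset V) (a b : V) : Prop :=
  ∃ p : G.Walk a b, ∀ z ∈ p.support, z ∈ S

namespace ReachableIn

variable {S T : Finset V} {a b d : V}

theorem refl (ha : a ∈ S) : G.ReachableIn S a a := ⟨.nil, by simpa using ha⟩

theorem right_mem (h : G.ReachableIn S a b) : b ∈ S := h.choose_spec _ (Walk.end_mem_support _)

theorem symm (h : G.ReachableIn S a b) : G.ReachableIn S b a := by
  obtain ⟨p, hp⟩ := h
  exact ⟨p.reverse, by simpa using hp⟩

theorem trans (h : G.ReachableIn S a b) (h' : G.ReachableIn S b d) : G.ReachableIn S a d := by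
  obtain ⟨p, hp⟩ := h
  obtain ⟨q, hq⟩ := h'
  refine ⟨p.append q, fun z hz => ?_⟩
  rcases (Walk.mem_support_append_iff _ _).1 hz with h | h
  exacts [hp z h, hq z h]

theorem mono (h : G.ReachableIn S a b) (hST : S ⊆ T) : G.ReachableIn T a b :=
  ⟨h.choose, fun z hz => hST (h.choose_spec z hz)⟩

theorem of_adj (h : G.Adj a b) (ha : a ∈ S) (hb : b ∈ S) : G.ReachableIn S a b :=
  ⟨h.toWalk, by simp [ha, hb]⟩

end ReachableIn

open Classical in
/-- The vertices of the connected component of `a` in the subgraph induced by `S`. -/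
noncomputable def componentIn (G : SimpleGraph V) (S : Finset V) (a : V) : Finset V :=
  {b ∈ S | G.ReachableIn S a b}

section componentIn

variable {S : Finset V} {a b d : V}

theorem mem_componentIn : b ∈ G.componentIn S a ↔ G.ReachableIn S a b := by
  simp only [componentIn, Finset.mem_filter, and_iff_right_iff_imp]
  exact fun h => h.right_mem

theorem componentIn_subset : G.componentIn S a ⊆ S := fun _ h => (mem_componentIn.1 h).right_mem

theorem self_mem_componentIn (ha : a ∈ S) : a ∈ G.componentIn S a :=
  mem_componentIn.2 (.refl ha)

theorem not_adj_of_mem_componentIn (hb : b ∈ G.componentIn S a) (hd : d ∈ S)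
    (hd' : d ∉ G.componentIn S a) : ¬ G.Adj b d := fun h =>
  hd' (mem_componentIn.2 ((mem_componentIn.1 hb).trans (.of_adj h (componentIn_subset hb) hd)))

theorem reachableIn_componentIn (hb : b ∈ G.componentIn S a) :
    G.ReachableIn (G.componentIn S a) a b := by
  classical
  obtain ⟨p, hp⟩ := mem_componentIn.1 hb
  refine ⟨p, fun z hz => mem_componentIn.2 ⟨p.takeUntil z hz, fun w hw => hp w ?_⟩⟩
  exact Walk.support_takeUntil_subset_support _ hz hw

end componentIn

/-- A walk ending in `T` has a first vertex in `T`, which is reached by a path. -/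
theorem Walk.exists_isPath_to_first {S : Set V} (T : Set V) {a b : V} (p : G.Walk a b)
    (hp : ∀ z ∈ p.support, z ∈ S) (hb : b ∈ T) :
    ∃ z ∈ T, ∃ q : G.Walk a z, q.IsPath ∧ (∀ w ∈ q.support, w ∈ S) ∧
      ∀ w ∈ q.support, w ∈ T → w = z := by
  classical
  induction p with
  | nil => exact ⟨_, hb, .nil, by simp, hp, by simp⟩
  | @cons a c b h p ih =>
    by_cases ha : a ∈ T
    · exact ⟨a, ha, .nil, by simp, by simpa using hp a (by simp), by simp⟩
    · obtain ⟨z, hz, q, -, hqS, hqT⟩ := ih (fun z hz => hp z (by simp [hz])) hb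
      have hsub : ∀ w ∈ (Walk.cons h q).bypass.support, w = a ∨ w ∈ q.support := fun w hw => by
        simpa using Walk.support_bypass_subset_support _ hw
      refine ⟨z, hz, (Walk.cons h q).bypass, Walk.bypass_isPath _, fun w hw => ?_,
        fun w hw hwT => ?_⟩
      · rcases hsub w hw with rfl | hw
        exacts [hp _ (by simp), hqS w hw]
      · rcases hsub w hw with rfl | hw
        exacts [absurd hwT ha, hqT w hw hwT]

/-- Two walks that are paths and meet only at the joint form a path. -/
theorem Walk.IsPath.append_of_inter {a b c : V} {p : G.Walk a b} {q : G.Walk b c}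
    (hp : p.IsPath) (hq : q.IsPath) (h : ∀ w ∈ p.support, w ∈ q.support → w = b) :
    (p.append q).IsPath := by
  rw [Walk.isPath_def, Walk.support_append, List.nodup_append]
  refine ⟨hp.support_nodup, hq.support_nodup.tail, fun w hw w' hw' => ?_⟩
  rintro rfl
  have hb := h w hw (List.mem_of_mem_tail hw')
  subst hb
  have := hq.support_nodup
  rw [← q.cons_tail_support, List.nodup_cons] at this
  exact this.1 hw'

/-- In an odd-cycle graph, a path between two neighbours of a vertex off the path is of odd
length. -/
theorem IsOddCycleGraph.odd_length (hG : G.IsOddCycleGraph) {a p q : V} (hp : G.Adj a p)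
    (hq : G.Adj a q) (hpq : p ≠ q) (P : G.Walk p q) (hP : P.IsPath) (ha : a ∉ P.support) :
    Odd P.length := by
  have hcyc : (Walk.cons hp (P.concat hq.symm)).IsCycle := by
    rw [Walk.isCycle_iff_isPath_tail_and_le_length]
    constructor
    · simpa using hP.concat ha hq.symm
    · have : P.length ≠ 0 := fun h => hpq (Walk.eq_of_length_eq_zero h)
      simp only [Walk.length_cons, Walk.length_concat]
      lia
  have := hG _ _ hcyc
  simp only [Walk.length_cons, Walk.length_concat] at this
  rw [Nat.odd_iff] at this ⊢
  lia

/-- In an odd-cycle graph, a connected set of vertices has at most two neighbours of any further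
vertex. -/
theorem IsOddCycleGraph.not_three_neighbors (hG : G.IsOddCycleGraph) {D : Finset V} {a p q r : V}
    (ha : a ∉ D) (hp : G.Adj a p) (hq : G.Adj a q) (hr : G.Adj a r) (hpq : p ≠ q) (hpr : p ≠ r)
    (hqr : q ≠ r) (hDq : G.ReachableIn D p q) (hDr : G.ReachableIn D p r) : False := by
  classical
  obtain ⟨P', hP'⟩ := hDq
  obtain ⟨R', hR'⟩ := hDr.symm
  set P := P'.bypass with hPdef
  have hP : P.IsPath := Walk.bypass_isPath _
  have hPD : ∀ z ∈ P.support, z ∈ D := fun z hz =>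
    hP' z (Walk.support_bypass_subset_support _ hz)
  -- The path `R` from `r` stops at its first vertex `z` on `P`, so `P₁`, `P₂` and `R` form a tripod
  -- centred at `z` with feet `p`, `q`, `r`.
  obtain ⟨z, hz, R, hR, hRD, hRP⟩ := R'.exists_isPath_to_first (S := (D : Set V))
    {w | w ∈ P.support} hR' (Walk.start_mem_support P)
  have hz : z ∈ P.support := hz
  set P₁ := P.takeUntil z hz
  set P₂ := P.dropUntil z hz
  have h₁ : P₁.IsPath := hP.takeUntil hz
  have h₂ : P₂.IsPath := hP.dropUntil hz
  have hs₁ : ∀ w ∈ P₁.support, w ∈ P.support := fun w hw =>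
    Walk.support_takeUntil_subset_support _ hz hw
  have hs₂ : ∀ w ∈ P₂.support, w ∈ P.support := fun w hw =>
    Walk.support_dropUntil_subset_support _ hz hw
  have hlen : P.length = P₁.length + P₂.length := by
    rw [← Walk.length_append, Walk.take_spec]
  have e₁ := hG.odd_length hp hq hpq P hP fun h => ha (hPD a h)
  have e₂ := hG.odd_length hr hp hpr.symm (R.append P₁.reverse)
    (hR.append_of_inter h₁.reverse fun w hw hw' => hRP w hw (hs₁ w (by simpa using hw'))) (by
      rw [Walk.mem_support_append_iff]
      rintro (h | h)
      exacts [ha (hRD a h), ha (hPD a (hs₁ a (by simpa using h)))])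
  have e₃ := hG.odd_length hr hq hqr.symm (R.append P₂)
    (hR.append_of_inter h₂ fun w hw hw' => hRP w hw (hs₂ w hw')) (by
      rw [Walk.mem_support_append_iff]
      rintro (h | h)
      exacts [ha (hRD a h), ha (hPD a (hs₂ a h))])
  -- Any two legs of the tripod have odd total length; adding the three sums counts every leg twice,
  -- so three odd numbers have an even sum.
  simp only [Walk.length_append, Walk.length_reverse] at e₂ e₃
  rw [Nat.odd_iff] at e₁ e₂ e₃
  lia

/-- If `a` separates `z` from `b`, then `b` does not separate `z` from `a`. -/
theorem ReachableIn.erase_or_erase [DecidableEq V] {S : Finset V} {z a b : V} (hab : a ≠ b)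
    (h : G.ReachableIn S z b) :
    G.ReachableIn (S.erase a) z b ∨ G.ReachableIn (S.erase b) z a := by
  obtain ⟨p', hp'⟩ := h
  set p := p'.bypass
  have hp : p.IsPath := Walk.bypass_isPath _
  have hpS : ∀ w ∈ p.support, w ∈ S := fun z hz => hp' z (Walk.support_bypass_subset_support _ hz)
  by_cases ha : a ∈ p.support
  · right
    refine ⟨p.takeUntil a ha, fun w hw => Finset.mem_erase.2 ⟨?_, hpS w ?_⟩⟩
    · rintro rfl
      exact Walk.endpoint_notMem_support_takeUntil hp ha hab.symm hw
    · exact Walk.support_takeUntil_subset_support _ ha hw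
  · left
    exact ⟨p, fun w hw => Finset.mem_erase.2 ⟨by rintro rfl; exact ha hw, hpS w hw⟩⟩

section branch

open Classical

variable {T : Finset V} {a b : V}

/-- The vertices of `T - a` that `a` separates from `b`. -/
noncomputable def branch (G : SimpleGraph V) (T : Finset V) (a b : V) : Finset V :=
  T.erase a \ G.componentIn (T.erase a) b

theorem branch_subset : G.branch T a b ⊆ (T.erase a).erase b := fun z hz => by
  rw [branch, Finset.mem_sdiff] at hz
  refine Finset.mem_erase.2 ⟨?_, hz.1⟩
  rintro rfl
  exact hz.2 (self_mem_componentIn hz.1)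

/-- A vertex cannot lie both behind `a` as seen from `b` and behind `b` as seen from `a`. This is
what lets the sizes of the two branches be added when `v` has two neighbours in a component. -/
theorem disjoint_branch (hab : a ≠ b) (hconn : ∀ z ∈ T, G.ReachableIn T z b) :
    Disjoint (G.branch T a b) (G.branch T b a) := by
  rw [Finset.disjoint_left]
  intro z hz hz'
  rw [branch, Finset.mem_sdiff] at hz hz'
  rcases (hconn z (Finset.mem_of_mem_erase hz.1)).erase_or_erase hab with h | h
  · exact hz.2 (mem_componentIn.2 h.symm)
  · exact hz'.2 (mem_componentIn.2 h.symm)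

theorem componentIn_union_sdiff (G : SimpleGraph V) (T : Finset V) (a : V) :
    G.componentIn T a ∪ (T \ G.componentIn T a) = T :=
  Finset.union_sdiff_of_subset componentIn_subset

theorem not_adj_componentIn_sdiff : ∀ p ∈ G.componentIn T a, ∀ q ∈ T \ G.componentIn T a,
    ¬ G.Adj p q := fun p hp q hq => by
  rw [Finset.mem_sdiff] at hq
  exact not_adj_of_mem_componentIn hp hq.1 hq.2

theorem card_componentIn_add (G : SimpleGraph V) (T : Finset V) (a : V) :
    (G.componentIn T a).card + (T \ G.componentIn T a).card = T.card := by
  rw [add_comm, Finset.card_sdiff_add_card_eq_card componentIn_subset]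

end branch

end SimpleGraph

/-! ### Real inequalities for the parity weight and the chord bound. -/

namespace SimpleGraph

/-- The number `s`, diminished by `1 / y` when `s` is odd. -/
noncomputable def parityWeight (y : ℝ) (s : ℕ) : ℝ := if Even s then s else s - 1 / y

section parityWeight

variable {y : ℝ} {s t : ℕ}

theorem parityWeight_of_even (hs : Even s) : parityWeight y s = s := if_pos hs

theorem parityWeight_of_odd (hs : Odd s) : parityWeight y s = s - 1 / y :=
  if_neg (Nat.not_even_iff_odd.2 hs)

@[simp] theorem parityWeight_zero : parityWeight y 0 = 0 := by simp [parityWeight]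

theorem parityWeight_add_two : parityWeight y (s + 2) = parityWeight y s + 2 := by
  rcases Nat.even_or_odd s with h | h
  · rw [parityWeight_of_even h, parityWeight_of_even (h.add even_two)]; push_cast; ring
  · rw [parityWeight_of_odd h, parityWeight_of_odd (h.add_even even_two)]; push_cast; ring

/-- Only two odd summands lose anything, namely `2 / y`. This inequality merges the bounds of
different components. -/
theorem parityWeight_add_le (hy : 1 < y) :
    parityWeight y s + parityWeight y t ≤ parityWeight y (s + t) := by
  have : 0 < 1 / y := by positivity
  rcases Nat.even_or_odd s with h | h <;> rcases Nat.even_or_odd t with h' | h'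
  · rw [parityWeight_of_even h, parityWeight_of_even h', parityWeight_of_even (h.add h')]
    push_cast; linarith
  · rw [parityWeight_of_even h, parityWeight_of_odd h', parityWeight_of_odd (h.add_odd h')]
    push_cast; linarith
  · rw [parityWeight_of_odd h, parityWeight_of_even h', parityWeight_of_odd (h.add_even h')]
    push_cast; linarith
  · rw [parityWeight_of_odd h, parityWeight_of_odd h', parityWeight_of_even (h.add_odd h')]
    push_cast; linarith

theorem parityWeight_add_lt (hy : 1 < y) (hs : Odd s) (ht : Odd t) :
    parityWeight y s + parityWeight y t < parityWeight y (s + t) := by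
  have : 0 < 1 / y := by positivity
  rw [parityWeight_of_odd hs, parityWeight_of_odd ht, parityWeight_of_even (hs.add_odd ht)]
  push_cast; linarith

theorem parityWeight_strictMono (hy : 1 < y) : StrictMono (parityWeight y) := by
  refine strictMono_nat_of_lt_succ fun s => ?_
  have h0 : 0 < 1 / y := by positivity
  have h1 : 1 / y < 1 := by rw [div_lt_one (by linarith)]; exact hy
  rcases Nat.even_or_odd s with h | h
  · rw [parityWeight_of_even h, parityWeight_of_odd h.add_one]; push_cast; linarith
  · rw [parityWeight_of_odd h, parityWeight_of_even h.add_one]; push_cast; linarith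

theorem parityWeight_nonneg (hy : 1 < y) : 0 ≤ parityWeight y s := by
  simpa using (parityWeight_strictMono hy).monotone (Nat.zero_le s)

/-- The numerical content of the single neighbour bound: it compares `(y - 1) / (y - 1 - w(s - 1))`
with `y / (y - 1) * w(s)`. For odd `s` the excess is a multiple of `y - 1 - w(s)`, which is why
strictness requires a weight below `y - 1`. -/
theorem sq_le_parityWeight_mul (hy : 1 < y) (hs : 1 ≤ s) (h : parityWeight y s ≤ y - 1) :
    (y - 1) ^ 2 ≤ y * parityWeight y s * (y - 1 - parityWeight y (s - 1)) ∧
      (2 ≤ s → parityWeight y s < y - 1 →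
        (y - 1) ^ 2 < y * parityWeight y s * (y - 1 - parityWeight y (s - 1))) := by
  obtain ⟨k, rfl⟩ := Nat.exists_eq_add_of_le' hs
  have hy0 : y ≠ 0 := by positivity
  rw [Nat.add_sub_cancel]
  rcases Nat.even_or_odd k with hk | hk
  · rw [parityWeight_of_odd hk.add_one] at h ⊢
    rw [parityWeight_of_even hk]
    push_cast at h ⊢
    have e : y * (k + 1 - 1 / y) * (y - 1 - k) = (y - 1) ^ 2 + y * k * (y - 1 - (k + 1 - 1 / y)) := by
      field_simp; ring
    rw [e]
    refine ⟨le_add_of_nonneg_right (by have := sub_nonneg.2 h; positivity), fun h2 h3 => ?_⟩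
    have hk1 : (1 : ℝ) ≤ k := by exact_mod_cast (by lia : 1 ≤ k)
    exact lt_add_of_pos_right _ (mul_pos (by positivity) (sub_pos.2 h3))
  · rw [parityWeight_of_even hk.add_one] at h ⊢
    rw [parityWeight_of_odd hk]
    push_cast at h ⊢
    have hk1 : (1 : ℝ) ≤ k := by exact_mod_cast hk.pos
    have e : y * (k + 1) * (y - 1 - (k - 1 / y)) =
        (y - 1) ^ 2 + (y * (k - 1) * (y - 1 - (k + 1)) + (2 * y - k - 1) * (y - 1) - (y - 1) ^ 2) := by
      field_simp; ring
    have h1 : 0 ≤ y * (k - 1) * (y - 1 - (k + 1)) :=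
      mul_nonneg (mul_nonneg (by linarith) (by linarith)) (by linarith)
    have h2 : (y - 1) ^ 2 < (2 * y - k - 1) * (y - 1) := by
      rw [sq]; exact mul_lt_mul_of_pos_right (by linarith) (by linarith)
    exact ⟨by rw [e]; linarith, fun _ _ => by rw [e]; linarith⟩

theorem one_sub_parityWeight_pos (hy : 1 < y) (hs : parityWeight y s ≤ y - 1) (h : 0 < s) :
    0 < 1 - parityWeight y (s - 1) / (y - 1) := by
  have := parityWeight_strictMono hy (Nat.sub_lt h one_pos)
  rw [sub_pos, div_lt_one (by linarith)]
  linarith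

end parityWeight

/-- The bound for the ratio `L(T - a) / L(T)` for an end `a` of a path through `T`, where `T` has
weight `σ` and the part of `T` that hangs at `a` has weight `u`. -/
noncomputable def chordBound (y σ u : ℝ) : ℝ := y * (y + 1 - σ + u) / (y ^ 2 - σ * y + 1)

section chordBound

variable {y σ u w : ℝ}

theorem chordBound_denom_pos (hy : 1 < y) (hσ : σ ≤ y - 1) : 0 < y ^ 2 - σ * y + 1 := by
  nlinarith

theorem one_le_mul_chordBound (hy : 1 < y) (hσ : σ ≤ y - 1) (hu : 0 ≤ u) (hw : 0 ≤ w)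
    (h : u + w ≤ σ - 2) :
    1 ≤ (1 - u / (y - 1) - (y - 1) / (y * (y - 1 - w))) * chordBound y σ u := by
  have hD := chordBound_denom_pos hy hσ
  have hP : 0 < y + 1 - σ + u := by linarith
  have hy1 : 0 < y - 1 := by linarith
  have hy0 : 0 < y := by linarith
  -- The worst case is `w = σ - 2 - u`, that is, equality in `h`.
  have hle : (y - 1) / (y * (y - 1 - w)) ≤ (y - 1) / (y * (y + 1 - σ + u)) := by
    apply div_le_div_of_nonneg_left hy1.le (by positivity)
    exact mul_le_mul_of_nonneg_left (by linarith) hy0.le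
  calc (1 : ℝ) ≤ (1 - u / (y - 1) - (y - 1) / (y * (y + 1 - σ + u))) * chordBound y σ u := by
        have e : (1 - u / (y - 1) - (y - 1) / (y * (y + 1 - σ + u))) * chordBound y σ u =
            (y * (y - 1 - u) * (y + 1 - σ + u) - (y - 1) ^ 2) / ((y - 1) * (y ^ 2 - σ * y + 1)) := by
          rw [chordBound]; field_simp
        rw [e, le_div_iff₀ (by positivity)]
        -- This product is exactly the difference of the two sides; it vanishes at `u = 0`, so the
        -- denominator of `chordBound` cannot be improved there.
        have : 0 ≤ y * u * (σ - 2 - u) := mul_nonneg (by positivity) (by linarith)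
        linear_combination this
    _ ≤ _ := by
        apply mul_le_mul_of_nonneg_right (by linarith)
        rw [chordBound]; positivity

/-- The sum of the two bounds depends on the branches only through `u + u'`. At the extreme `u + u'
= σ - 2` the remaining slack is governed by `y * (σ - 2) * (y - 1 - σ)`. It disappears at the
critical weight `σ = y - 1`, where strictness must come from smaller branches instead. -/
theorem chordBound_add_le {u' : ℝ} (hy : 1 < y) (hσ : σ ≤ y - 1) (hσ2 : 2 ≤ σ)
    (h : u + u' ≤ σ - 2) :
    chordBound y σ u + chordBound y σ u' ≤ y / (y - 1) * σ ∧
      (2 < σ → (σ < y - 1 ∨ u + u' < σ - 2) →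
        chordBound y σ u + chordBound y σ u' < y / (y - 1) * σ) := by
  have hD := chordBound_denom_pos hy hσ
  have hy1 : 0 < y - 1 := by linarith
  have e : chordBound y σ u + chordBound y σ u' =
      y * (2 * y + 2 - 2 * σ + (u + u')) / (y ^ 2 - σ * y + 1) := by
    rw [chordBound, chordBound, ← add_div]; ring
  have e' : y / (y - 1) * σ = y * σ / (y - 1) := by ring
  have key : (2 * y - σ) * (y - 1) + y * (σ - 2) * (y - 1 - σ) = σ * (y ^ 2 - σ * y + 1) := by ring
  rw [e, e', div_le_div_iff₀ hD hy1, div_lt_div_iff₀ hD hy1, mul_assoc, mul_assoc]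
  have h0 : 0 ≤ y * (σ - 2) * (y - 1 - σ) :=
    mul_nonneg (mul_nonneg (by linarith) (by linarith)) (by linarith)
  have h1 : (2 * y + 2 - 2 * σ + (u + u')) * (y - 1) ≤ (2 * y - σ) * (y - 1) :=
    mul_le_mul_of_nonneg_right (by linarith) hy1.le
  refine ⟨mul_le_mul_of_nonneg_left (by linarith) (by linarith), fun h2 h3 => ?_⟩
  apply mul_lt_mul_of_pos_left _ (by linarith)
  rcases h3 with h3 | h3
  · have : 0 < y * (σ - 2) * (y - 1 - σ) :=
      mul_pos (mul_pos (by linarith) (by linarith)) (by linarith)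
    linarith
  · have : (2 * y + 2 - 2 * σ + (u + u')) * (y - 1) < (2 * y - σ) * (y - 1) :=
      mul_lt_mul_of_pos_right (by linarith) hy1
    linarith

end chordBound

end SimpleGraph

/-! ### The balance inequality for odd-cycle graphs. -/

namespace SimpleGraph

open Classical

variable {V : Type*} [Fintype V] {G : SimpleGraph V}

/-- The sum of the matching sums of `T - u` over the neighbours `u` of `v` in `T`. -/
noncomputable def neighborSum (G : SimpleGraph V) (c : ℝ) (v : V) (T : Finset V) : ℝ :=
  ∑ u ∈ T with G.Adj v u, G.matchingSum c (T.erase u)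

theorem matchingSum_eq_sub {y : ℝ} {T : Finset V} {a : V} (ha : a ∈ T) :
    G.matchingSum (-1 / y) T = G.matchingSum (-1 / y) (T.erase a) -
      1 / y * G.neighborSum (-1 / y) a (T.erase a) := by
  rw [matchingSum_erase _ ha, neighborSum]; ring

theorem neighborSum_union (c : ℝ) (v : V) {S T : Finset V} (hd : Disjoint S T)
    (h : ∀ a ∈ S, ∀ b ∈ T, ¬ G.Adj a b) :
    G.neighborSum c v (S ∪ T) =
      G.neighborSum c v S * G.matchingSum c T + G.matchingSum c S * G.neighborSum c v T := by
  rw [neighborSum, Finset.filter_union, Finset.sum_union (Finset.disjoint_filter_filter hd),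
    neighborSum, neighborSum, Finset.sum_mul, Finset.mul_sum]
  congr 1
  · refine Finset.sum_congr rfl fun u hu => ?_
    have hu := (Finset.mem_filter.1 hu).1
    rw [Finset.erase_union_distrib, Finset.erase_eq_of_notMem (Finset.disjoint_left.1 hd hu)]
    exact matchingSum_union c (hd.mono_left (Finset.erase_subset _ _))
      fun a ha => h a (Finset.mem_of_mem_erase ha)
  · refine Finset.sum_congr rfl fun u hu => ?_
    have hu := (Finset.mem_filter.1 hu).1
    rw [Finset.erase_union_distrib, Finset.erase_eq_of_notMem (Finset.disjoint_right.1 hd hu)]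
    exact matchingSum_union c (hd.mono_right (Finset.erase_subset _ _))
      fun a ha b hb => h a ha b (Finset.mem_of_mem_erase hb)

/-- The matching sum of `T` is positive, and the ratios `L(T - u) / L(T)` over the neighbours `u`
of an outside vertex sum up to at most `y / (y - 1)` times the weight of `T`. -/
def IsBalanced (G : SimpleGraph V) (y : ℝ) (T : Finset V) : Prop :=
  0 < G.matchingSum (-1 / y) T ∧ ∀ v ∉ T, G.neighborSum (-1 / y) v T ≤
    y / (y - 1) * parityWeight y T.card * G.matchingSum (-1 / y) T

variable {y : ℝ} {T : Finset V} {a b v : V}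

/-- Insert the bound for `T - a`, with outside vertex `a`, into the deletion recurrence. This one
step yields positivity, the single neighbour bound and the final estimate for the whole vertex set.
-/
theorem IsBalanced.erase_mul_le (hy : 1 < y) (ha : a ∈ T) (h : G.IsBalanced y (T.erase a)) :
    G.matchingSum (-1 / y) (T.erase a) * (1 - parityWeight y (T.card - 1) / (y - 1)) ≤
      G.matchingSum (-1 / y) T := by
  have h2 := h.2 a (Finset.notMem_erase _ _)
  rw [Finset.card_erase_of_mem ha] at h2
  rw [matchingSum_eq_sub ha]
  have h3 := mul_le_mul_of_nonneg_left h2 (by positivity : 0 ≤ 1 / y)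
  have e : 1 / y * (y / (y - 1) * parityWeight y (T.card - 1) *
      G.matchingSum (-1 / y) (T.erase a)) =
      G.matchingSum (-1 / y) (T.erase a) * (parityWeight y (T.card - 1) / (y - 1)) := by
    field_simp
  rw [e] at h3
  linarith

theorem IsBalanced.pos_of_erase (hy : 1 < y) (hT : parityWeight y T.card ≤ y - 1) (ha : a ∈ T)
    (h : G.IsBalanced y (T.erase a)) : 0 < G.matchingSum (-1 / y) T :=
  (mul_pos h.1 (one_sub_parityWeight_pos hy hT (Finset.card_pos.2 ⟨a, ha⟩))).trans_le (h.erase_mul_le hy ha)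

theorem IsBalanced.erase_le (hy : 1 < y) (hT : parityWeight y T.card ≤ y - 1) (ha : a ∈ T)
    (h : G.IsBalanced y (T.erase a)) :
    G.matchingSum (-1 / y) (T.erase a) ≤
      (y - 1) / (y - 1 - parityWeight y (T.card - 1)) * G.matchingSum (-1 / y) T := by
  have h1 := one_sub_parityWeight_pos hy hT (Finset.card_pos.2 ⟨a, ha⟩)
  have h2 := h.erase_mul_le hy ha
  have e : 1 - parityWeight y (T.card - 1) / (y - 1) =
      (y - 1 - parityWeight y (T.card - 1)) / (y - 1) := by
    have : y - 1 ≠ 0 := by linarith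
    field_simp
  rw [e] at h1 h2
  rw [mul_comm, ← inv_div (y - 1 - _), ← div_eq_mul_inv, le_div_iff₀ h1]
  exact h2

/-- The single neighbour bound. -/
theorem IsBalanced.erase_le_parityWeight (hy : 1 < y) (hT : parityWeight y T.card ≤ y - 1)
    (ha : a ∈ T) (h : G.IsBalanced y (T.erase a)) :
    G.matchingSum (-1 / y) (T.erase a) ≤
        y / (y - 1) * parityWeight y T.card * G.matchingSum (-1 / y) T ∧
      (2 ≤ T.card → parityWeight y T.card < y - 1 → G.matchingSum (-1 / y) (T.erase a) <
        y / (y - 1) * parityWeight y T.card * G.matchingSum (-1 / y) T) := by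
  have hpos := h.pos_of_erase hy hT ha
  have h1 := h.erase_le hy hT ha
  have hc : 1 ≤ T.card := Finset.card_pos.2 ⟨a, ha⟩
  obtain ⟨h2, h3⟩ := sq_le_parityWeight_mul hy hc hT
  have hlt : 0 < y - 1 - parityWeight y (T.card - 1) := by
    have := parityWeight_strictMono hy (Nat.sub_lt hc one_pos)
    linarith
  have hy1 : 0 < y - 1 := by linarith
  have e : y / (y - 1) * parityWeight y T.card = y * parityWeight y T.card / (y - 1) := by ring
  refine ⟨h1.trans (mul_le_mul_of_nonneg_right ?_ hpos.le), fun h4 h5 =>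
    h1.trans_lt (mul_lt_mul_of_pos_right ?_ hpos)⟩
  · rw [e, div_le_div_iff₀ hlt hy1]
    linarith
  · have := h3 h4 h5
    rw [e, div_lt_div_iff₀ hlt hy1]
    linarith

/-- If `a` has at most one neighbour in `D`, the ratios sum up to at most a single one. -/
theorem neighborSum_le_of_card_le_one (hy : 1 < y) {D : Finset V} (hD : D.Nonempty)
    (hw : parityWeight y D.card ≤ y - 1) (hb : ∀ p ∈ D, G.IsBalanced y (D.erase p))
    (h1 : ∀ p ∈ D, ∀ q ∈ D, G.Adj a p → G.Adj a q → p = q) :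
    G.neighborSum (-1 / y) a D ≤
      (y - 1) / (y - 1 - parityWeight y (D.card - 1)) * G.matchingSum (-1 / y) D := by
  have hpos : 0 < G.matchingSum (-1 / y) D := by
    obtain ⟨p, hp⟩ := hD
    exact (hb p hp).pos_of_erase hy hw hp
  rw [neighborSum]
  rcases (D.filter (G.Adj a)).eq_empty_or_nonempty with he | ⟨p, hp⟩
  · rw [he, Finset.sum_empty]
    have := parityWeight_strictMono hy (Nat.sub_lt hD.card_pos one_pos)
    exact mul_nonneg (div_nonneg (by linarith) (by linarith)) hpos.le
  · have : D.filter (G.Adj a) = {p} := by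
      refine Finset.eq_singleton_iff_unique_mem.2 ⟨hp, fun q hq => ?_⟩
      rw [Finset.mem_filter] at hp hq
      exact h1 q hq.1 p hp.1 hq.2 hp.2
    rw [this, Finset.sum_singleton]
    have hp := (Finset.mem_filter.1 hp).1
    exact (hb p hp).erase_le hy hw hp

/-- If `T - a` splits into `D`, in which `a` has at most one neighbour, and `K`, then `L(T - a)` is
bounded in terms of the weight of `K`. -/
theorem erase_le_chordBound (hy : 1 < y) (hT : parityWeight y T.card ≤ y - 1) (ha : a ∈ T)
    (ih : ∀ S ⊂ T, G.IsBalanced y S) {D K : Finset V} (hD : D.Nonempty) (hDK : Disjoint D K)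
    (hT' : T.erase a = D ∪ K) (hadj : ∀ d ∈ D, ∀ k ∈ K, ¬ G.Adj d k)
    (h1 : ∀ p ∈ D, ∀ q ∈ D, G.Adj a p → G.Adj a q → p = q) {u : ℝ} (hu : 0 ≤ u)
    (hK : G.neighborSum (-1 / y) a K ≤ y / (y - 1) * u * G.matchingSum (-1 / y) K)
    (hw : u + parityWeight y (D.card - 1) ≤ parityWeight y T.card - 2) :
    G.matchingSum (-1 / y) (T.erase a) ≤
      chordBound y (parityWeight y T.card) u * G.matchingSum (-1 / y) T := by
  have hsub : D ∪ K ⊂ T := hT' ▸ Finset.erase_ssubset ha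
  have hDT : D ⊂ T := Finset.subset_union_left.trans_ssubset hsub
  have hKT : K ⊂ T := Finset.subset_union_right.trans_ssubset hsub
  have hw' : parityWeight y D.card ≤ y - 1 :=
    ((parityWeight_strictMono hy).monotone (Finset.card_le_card hDT.1)).trans hT
  have hDn := neighborSum_le_of_card_le_one (a := a) hy hD hw'
    (fun p hp => ih _ ((Finset.erase_subset _ _).trans_ssubset hDT)) h1
  have hposD := (ih D hDT).1
  have hposK := (ih K hKT).1
  have hlt : 0 < y - 1 - parityWeight y (D.card - 1) := by
    have := parityWeight_strictMono hy (Nat.sub_lt hD.card_pos one_pos)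
    linarith
  have hy1 : 0 < y - 1 := by linarith
  have hy0 : 0 < y := by linarith
  have hL := matchingSum_eq_sub (G := G) (y := y) ha
  have hm : G.matchingSum (-1 / y) (T.erase a) =
      G.matchingSum (-1 / y) D * G.matchingSum (-1 / y) K := by
    rw [hT', matchingSum_union _ hDK hadj]
  have hmpos : 0 < G.matchingSum (-1 / y) (T.erase a) := hm ▸ mul_pos hposD hposK
  rw [hT', neighborSum_union _ _ hDK hadj, ← hT'] at hL
  have hchord := one_le_mul_chordBound hy hT hu (parityWeight_nonneg hy) hw
  set A := 1 - u / (y - 1) - (y - 1) / (y * (y - 1 - parityWeight y (D.card - 1))) with hA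
  have hcpos : 0 ≤ chordBound y (parityWeight y T.card) u := by
    have := chordBound_denom_pos hy hT
    exact div_nonneg (mul_nonneg hy0.le (by linarith)) this.le
  -- In the recurrence at `a`, the factor `A` loses `u / (y - 1)` to the neighbours in `K` and the
  -- other fraction to the at most one neighbour in `D`.
  have hstep : A * G.matchingSum (-1 / y) (T.erase a) ≤ G.matchingSum (-1 / y) T := by
    have h2 := mul_le_mul_of_nonneg_right hDn hposK.le
    have h3 := mul_le_mul_of_nonneg_left hK hposD.le
    have h4 := mul_le_mul_of_nonneg_left (add_le_add h2 h3) (by positivity : 0 ≤ 1 / y)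
    have e : A * G.matchingSum (-1 / y) (T.erase a) = G.matchingSum (-1 / y) (T.erase a) - 1 / y *
        ((y - 1) / (y - 1 - parityWeight y (D.card - 1)) * G.matchingSum (-1 / y) D *
          G.matchingSum (-1 / y) K + G.matchingSum (-1 / y) D *
          (y / (y - 1) * u * G.matchingSum (-1 / y) K)) := by
      rw [hm, hA]; field_simp; ring
    rw [e, hL]
    linarith
  calc _ ≤ A * chordBound y (parityWeight y T.card) u * G.matchingSum (-1 / y) (T.erase a) :=
        le_mul_of_one_le_left hmpos.le hchord
    _ = chordBound y (parityWeight y T.card) u * (A * G.matchingSum (-1 / y) (T.erase a)) := by ring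
    _ ≤ _ := mul_le_mul_of_nonneg_left hstep hcpos

/-- Here `D` is the component of `b` in `T - a`, and the rest is the branch at `a`. The outside
vertex `v` ties `a` and `b` together and thereby limits the neighbours of `a` in `D` to one. -/
theorem erase_le_chordBound_branch (hG : G.IsOddCycleGraph) (hy : 1 < y)
    (hT : parityWeight y T.card ≤ y - 1) (ha : a ∈ T) (hb : b ∈ T) (hab : a ≠ b) (hv : v ∉ T)
    (hva : G.Adj v a) (hvb : G.Adj v b) (ih : ∀ S ⊂ T, G.IsBalanced y S) :
    G.matchingSum (-1 / y) (T.erase a) ≤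
      chordBound y (parityWeight y T.card) (parityWeight y (G.branch T a b).card) *
        G.matchingSum (-1 / y) T := by
  set D := G.componentIn (T.erase a) b with hDdef
  have hbD : b ∈ D := self_mem_componentIn (Finset.mem_erase.2 ⟨hab.symm, hb⟩)
  have hDs : D ⊆ T.erase a := componentIn_subset
  have hKT : G.branch T a b ⊂ T :=
    (Finset.sdiff_subset.trans (Finset.Subset.refl _)).trans_ssubset (Finset.erase_ssubset ha)
  have hDK : Disjoint D (G.branch T a b) := Finset.disjoint_sdiff
  have hunion : T.erase a = D ∪ G.branch T a b := (Finset.union_sdiff_of_subset hDs).symm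
  refine erase_le_chordBound hy hT ha ih ⟨b, hbD⟩ hDK hunion
    (fun d hd k hk => ?_) (fun p hp q hq hap haq => ?_) (parityWeight_nonneg hy)
    ((ih _ hKT).2 a fun h => ?_) ?_
  · rw [branch, Finset.mem_sdiff] at hk
    exact not_adj_of_mem_componentIn hd hk.1 hk.2
  · by_contra hpq
    have hvD : v ∉ D := fun h => hv (Finset.mem_of_mem_erase (hDs h))
    have hsub : D ⊆ insert v D := Finset.subset_insert _ _
    have hbp := (reachableIn_componentIn hp).mono hsub
    have hbq := (reachableIn_componentIn hq).mono hsub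
    -- `D` together with `v` is connected through the edge `vb`, and it already contains the
    -- neighbour `v` of `a`; two more in `D` would make three.
    refine hG.not_three_neighbors (D := insert v D) (a := a) (p := p) (q := q) (r := v) ?_ hap haq
      hva.symm hpq ?_ ?_ (hbp.symm.trans hbq) (hbp.symm.trans
        (.of_adj hvb.symm (Finset.mem_insert_of_mem hbD) (Finset.mem_insert_self _ _)))
    · rw [Finset.mem_insert, not_or]
      exact ⟨hva.ne', fun h => Finset.notMem_erase a T (hDs h)⟩
    · rintro rfl; exact hvD hp
    · rintro rfl; exact hvD hq
  · exact Finset.notMem_erase a T (Finset.sdiff_subset h)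
  · have hcard : (T.erase a).card = D.card + (G.branch T a b).card := by
      rw [hunion, Finset.card_union_of_disjoint hDK]
    rw [Finset.card_erase_of_mem ha] at hcard
    have hDpos : 0 < D.card := Finset.card_pos.2 ⟨b, hbD⟩
    -- The `2` accounts for `a` and for the one vertex subtracted from `D`.
    have : T.card = (G.branch T a b).card + (D.card - 1) + 2 := by lia
    rw [this, parityWeight_add_two]
    have := parityWeight_add_le (s := (G.branch T a b).card) (t := D.card - 1) hy
    linarith

/-- The bound for a connected set, with a description of the cases of equality. -/
theorem neighborSum_le_of_connected (hG : G.IsOddCycleGraph) (hy : 1 < y)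
    (hT : parityWeight y T.card ≤ y - 1) (ha : a ∈ T) (hv : v ∉ T) (hva : G.Adj v a)
    (hconn : ∀ z ∈ T, G.ReachableIn T a z) (ih : ∀ S ⊂ T, G.IsBalanced y S) :
    G.neighborSum (-1 / y) v T ≤
        y / (y - 1) * parityWeight y T.card * G.matchingSum (-1 / y) T ∧
      (parityWeight y T.card < y - 1 → G.neighborSum (-1 / y) v T =
        y / (y - 1) * parityWeight y T.card * G.matchingSum (-1 / y) T →
          T.card ≤ 2 ∧ ∀ z ∈ T, G.Adj v z) := by
  have hpos : 0 < G.matchingSum (-1 / y) T :=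
    (ih _ (Finset.erase_ssubset ha)).pos_of_erase hy hT ha
  by_cases hb : ∃ b ∈ T, b ≠ a ∧ G.Adj v b
  · obtain ⟨b, hb, hba, hvb⟩ := hb
    have hab := hba.symm
    have hfil : T.filter (G.Adj v) = {a, b} := by
      ext z
      simp only [Finset.mem_filter, Finset.mem_insert, Finset.mem_singleton]
      constructor
      · rintro ⟨hz, hvz⟩
        by_contra! hne
        exact hG.not_three_neighbors hv hva hvb hvz hab hne.1.symm hne.2.symm (hconn b hb)
          (hconn z hz)
      · rintro (rfl | rfl)
        exacts [⟨ha, hva⟩, ⟨hb, hvb⟩]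
    have h1 := erase_le_chordBound_branch hG hy hT ha hb hab hv hva hvb ih
    have h2 := erase_le_chordBound_branch hG hy hT hb ha hba hv hvb hva ih
    have hdisj := disjoint_branch hab fun z hz => (hconn z hz).symm.trans (hconn b hb)
    have hcard : (G.branch T a b).card + (G.branch T b a).card + 2 ≤ T.card := by
      rw [← Finset.card_union_of_disjoint hdisj]
      have hs : G.branch T a b ∪ G.branch T b a ⊆ (T.erase a).erase b := by
        refine Finset.union_subset branch_subset ?_
        rw [Finset.erase_right_comm]
        exact branch_subset
      have := Finset.card_le_card hs
      have h2 : 2 ≤ T.card := by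
        rw [← Finset.card_pair hab, ← hfil]
        exact Finset.card_filter_le _ _
      rw [Finset.card_erase_of_mem (Finset.mem_erase.2 ⟨hba, hb⟩),
        Finset.card_erase_of_mem ha] at this
      lia
    have hσ : parityWeight y (G.branch T a b).card + parityWeight y (G.branch T b a).card ≤
        parityWeight y T.card - 2 := by
      have := (parityWeight_strictMono hy).monotone hcard
      rw [parityWeight_add_two] at this
      have := parityWeight_add_le (s := (G.branch T a b).card) (t := (G.branch T b a).card) hy
      linarith
    have hσ2 : 2 ≤ parityWeight y T.card := by
      have := parityWeight_nonneg (s := (G.branch T a b).card) hy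
      have := parityWeight_nonneg (s := (G.branch T b a).card) hy
      linarith
    -- Both branches avoid `a` and `b`, so their joint weight is at most that of `T` minus two, as
    -- required here.
    obtain ⟨h3, h4⟩ := chordBound_add_le hy hT hσ2 hσ
    rw [neighborSum, hfil, Finset.sum_pair hab]
    refine ⟨?_, fun h5 h6 => ?_⟩
    · have := mul_le_mul_of_nonneg_right h3 hpos.le
      linarith
    · have hle : T.card ≤ 2 := by
        by_contra! hlt
        have h7 := parityWeight_strictMono hy hlt
        rw [parityWeight_of_even (by decide)] at h7
        have := mul_lt_mul_of_pos_right (h4 (by exact_mod_cast h7) (.inl h5)) hpos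
        linarith
      refine ⟨hle, fun z hz => ?_⟩
      have : T.filter (G.Adj v) = T := by
        refine Finset.eq_of_subset_of_card_le (Finset.filter_subset _ _) ?_
        rw [hfil, Finset.card_pair hab]; exact hle
      rw [← this] at hz
      exact (Finset.mem_filter.1 hz).2
  · push Not at hb
    have hfil : T.filter (G.Adj v) = {a} := by
      ext z
      simp only [Finset.mem_filter, Finset.mem_singleton]
      constructor
      · rintro ⟨hz, hvz⟩
        by_contra hne
        exact hb z hz hne hvz
      · rintro rfl
        exact ⟨ha, hva⟩
    obtain ⟨h1, h2⟩ := (ih _ (Finset.erase_ssubset ha)).erase_le_parityWeight hy hT ha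
    rw [neighborSum, hfil, Finset.sum_singleton]
    refine ⟨h1, fun h3 h4 => ?_⟩
    have hle : T.card ≤ 1 := by
      by_contra! hlt
      exact (h2 hlt h3).ne h4
    refine ⟨by lia, fun z hz => ?_⟩
    rwa [Finset.card_le_one.1 hle z hz a ha]

theorem neighborSum_split (c : ℝ) (v : V) (T : Finset V) (a : V) :
    G.neighborSum c v T = G.neighborSum c v (G.componentIn T a) *
        G.matchingSum c (T \ G.componentIn T a) +
      G.matchingSum c (G.componentIn T a) * G.neighborSum c v (T \ G.componentIn T a) := by
  conv_lhs => rw [← componentIn_union_sdiff G T a]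
  exact neighborSum_union c v Finset.disjoint_sdiff not_adj_componentIn_sdiff

theorem matchingSum_split (c : ℝ) (T : Finset V) (a : V) :
    G.matchingSum c T = G.matchingSum c (G.componentIn T a) *
        G.matchingSum c (T \ G.componentIn T a) := by
  conv_lhs => rw [← componentIn_union_sdiff G T a]
  exact matchingSum_union c Finset.disjoint_sdiff not_adj_componentIn_sdiff

/-- Strong induction on `T`. If `T` is disconnected, a component containing a neighbour of `v` is
split off: the ratios add because `L` is multiplicative, and the weights add up by superadditivity.
-/
theorem isBalanced (hG : G.IsOddCycleGraph) (hy : 1 < y) (T : Finset V)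
    (hT : parityWeight y T.card ≤ y - 1) : G.IsBalanced y T := by
  induction T using Finset.strongInduction with
  | H T ih =>
    have ih' : ∀ S ⊂ T, G.IsBalanced y S := fun S hS => ih S hS
      (((parityWeight_strictMono hy).monotone (Finset.card_le_card hS.1)).trans hT)
    have hpos : 0 < G.matchingSum (-1 / y) T := by
      rcases T.eq_empty_or_nonempty with rfl | ⟨a, ha⟩
      · simp
      · exact (ih' _ (Finset.erase_ssubset ha)).pos_of_erase hy hT ha
    refine ⟨hpos, fun v hv => ?_⟩
    by_cases ha : ∃ a ∈ T, G.Adj v a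
    · obtain ⟨a, ha, hva⟩ := ha
      by_cases hC : G.componentIn T a = T
      · exact (neighborSum_le_of_connected hG hy hT ha hv hva
          (fun z hz => mem_componentIn.1 (hC.symm ▸ hz)) ih').1
      · have hC1 : G.componentIn T a ⊂ T := componentIn_subset.ssubset_of_ne hC
        have hC2 : T \ G.componentIn T a ⊂ T :=
          Finset.sdiff_ssubset componentIn_subset ⟨a, self_mem_componentIn ha⟩
        have h1 := (ih' _ hC1).2 v fun h => hv (hC1.1 h)
        have h2 := (ih' _ hC2).2 v fun h => hv (hC2.1 h)
        rw [neighborSum_split _ _ T a, matchingSum_split _ T a, ← card_componentIn_add G T a]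
        rw [matchingSum_split _ T a] at hpos
        have h3 := mul_le_mul_of_nonneg_right h1 (ih' _ hC2).1.le
        have h4 := mul_le_mul_of_nonneg_left h2 (ih' _ hC1).1.le
        have h5 := mul_le_mul_of_nonneg_right (mul_le_mul_of_nonneg_left
          (parityWeight_add_le (s := (G.componentIn T a).card)
            (t := (T \ G.componentIn T a).card) hy)
          (div_nonneg (by linarith) (by linarith) : 0 ≤ y / (y - 1))) hpos.le
        linarith
    · have : T.filter (G.Adj v) = ∅ := by
        rw [Finset.filter_eq_empty_iff]
        exact fun z hz h => ha ⟨z, hz, h⟩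
      rw [neighborSum, this, Finset.sum_empty]
      exact mul_nonneg (mul_nonneg (div_nonneg (by linarith) (by linarith))
        (parityWeight_nonneg hy)) hpos.le

end SimpleGraph

/-! ### The case of equality: fans. -/

namespace SimpleGraph

section

open Classical

variable {V : Type*} {G : SimpleGraph V}

/-- The vertices of `T` without neighbours in `T`. -/
noncomputable def isolatedIn (G : SimpleGraph V) (T : Finset V) : Finset V :=
  {u ∈ T | ∀ w ∈ T, ¬ G.Adj u w}

theorem mem_isolatedIn {T : Finset V} {u : V} :
    u ∈ G.isolatedIn T ↔ u ∈ T ∧ ∀ w ∈ T, ¬ G.Adj u w := by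
  simp [isolatedIn]

/-- Every vertex of `T` is adjacent to `v`, and `T` has `0` or `1` vertices without neighbours
in `T`, according to its parity. -/
def IsFanOver (G : SimpleGraph V) (v : V) (T : Finset V) : Prop :=
  (∀ z ∈ T, G.Adj v z) ∧ (G.isolatedIn T).card = T.card % 2

theorem isFanOver_empty {v : V} : G.IsFanOver v ∅ := ⟨by simp, by simp [isolatedIn]⟩

theorem ReachableIn.exists_adj {T : Finset V} {u z : V} (h : G.ReachableIn T u z) (huz : u ≠ z) :
    ∃ w ∈ T, G.Adj u w := by
  obtain ⟨p, hp⟩ := h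
  cases p with
  | nil => exact absurd rfl huz
  | cons h p => exact ⟨_, hp _ (by simp), h⟩

theorem isFanOver_of_connected {T : Finset V} {v a : V} (ha : a ∈ T)
    (hconn : ∀ z ∈ T, G.ReachableIn T a z) (hcard : T.card ≤ 2) (h : ∀ z ∈ T, G.Adj v z) :
    G.IsFanOver v T := by
  refine ⟨h, ?_⟩
  have hpos : 0 < T.card := Finset.card_pos.2 ⟨a, ha⟩
  rcases (by lia : T.card = 1 ∨ T.card = 2) with h1 | h2
  · obtain ⟨b, rfl⟩ := Finset.card_eq_one.1 h1
    have : G.isolatedIn {b} = {b} := by ext u; simp +contextual [mem_isolatedIn]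
    rw [this]
    simp
  · rw [h2, Finset.card_eq_zero, Finset.eq_empty_iff_forall_notMem]
    intro u hu
    obtain ⟨hu, hiso⟩ := mem_isolatedIn.1 hu
    obtain ⟨z, hz, hzu⟩ := Finset.exists_mem_ne (by lia : 1 < T.card) u
    obtain ⟨w, hw, huw⟩ := ((hconn u hu).symm.trans (hconn z hz)).exists_adj hzu.symm
    exact hiso w hw huw

theorem IsFanOver.union {S T : Finset V} {v : V} (hS : G.IsFanOver v S) (hT : G.IsFanOver v T)
    (hd : Disjoint S T) (h : ∀ a ∈ S, ∀ b ∈ T, ¬ G.Adj a b) (hodd : ¬ (Odd S.card ∧ Odd T.card)) :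
    G.IsFanOver v (S ∪ T) := by
  refine ⟨fun z hz => ?_, ?_⟩
  · rcases Finset.mem_union.1 hz with hz | hz
    exacts [hS.1 z hz, hT.1 z hz]
  · have h1 : G.isolatedIn (S ∪ T) = G.isolatedIn S ∪ G.isolatedIn T := by
      ext u
      simp only [mem_isolatedIn, Finset.mem_union]
      constructor
      · rintro ⟨hu | hu, h'⟩
        exacts [.inl ⟨hu, fun w hw => h' w (.inl hw)⟩, .inr ⟨hu, fun w hw => h' w (.inr hw)⟩]
      · rintro (⟨hu, h'⟩ | ⟨hu, h'⟩)
        · exact ⟨.inl hu, fun w hw => hw.elim (h' w) (h u hu w)⟩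
        · exact ⟨.inr hu, fun w hw => hw.elim (fun hw hadj => h w hw u hu hadj.symm) (h' w)⟩
    have h2 : Disjoint (G.isolatedIn S) (G.isolatedIn T) :=
      hd.mono (Finset.filter_subset _ _) (Finset.filter_subset _ _)
    rw [h1, Finset.card_union_of_disjoint h2, Finset.card_union_of_disjoint hd, hS.2, hT.2]
    simp only [Nat.odd_iff] at hodd
    lia

variable [Fintype V] {y : ℝ} {T : Finset V} {a b v : V}

/-- The bound on the neighbour sum is attained. -/
def IsTight (G : SimpleGraph V) (y : ℝ) (v : V) (T : Finset V) : Prop :=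
  G.neighborSum (-1 / y) v T = y / (y - 1) * parityWeight y T.card * G.matchingSum (-1 / y) T

/-- Tightness of the sum forces tightness of both parts and equality in the superadditivity of the
weight. The latter excludes two odd parts, so at most one isolated vertex remains. -/
theorem IsTight.isFanOver_of_split (hG : G.IsOddCycleGraph) (hy : 1 < y)
    (hT : parityWeight y T.card ≤ y - 1) (hv : v ∉ T) (ha : a ∈ T) (hC : G.componentIn T a ≠ T)
    (ih : ∀ S ⊂ T, G.IsTight y v S → G.IsFanOver v S) (h : G.IsTight y v T) :
    G.IsFanOver v T := by
  have hb : ∀ S ⊂ T, G.IsBalanced y S := fun S hS => isBalanced hG hy S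
      (((parityWeight_strictMono hy).monotone (Finset.card_le_card hS.1)).trans hT)
  have hC1 : G.componentIn T a ⊂ T := componentIn_subset.ssubset_of_ne hC
  have hC2 : T \ G.componentIn T a ⊂ T :=
    Finset.sdiff_ssubset componentIn_subset ⟨a, self_mem_componentIn ha⟩
  have hp1 := (hb _ hC1).1
  have hp2 := (hb _ hC2).1
  have h1 := (hb _ hC1).2 v fun h => hv (hC1.1 h)
  have h2 := (hb _ hC2).2 v fun h => hv (hC2.1 h)
  have hκ : 0 < y / (y - 1) := div_pos (by linarith) (by linarith)
  unfold IsTight at h ih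
  rw [neighborSum_split _ _ T a, matchingSum_split _ T a, ← card_componentIn_add G T a] at h
  have h3 := mul_le_mul_of_nonneg_right h1 hp2.le
  have h4 := mul_le_mul_of_nonneg_left h2 hp1.le
  have h5 := mul_le_mul_of_nonneg_right (mul_le_mul_of_nonneg_left
    (parityWeight_add_le (s := (G.componentIn T a).card)
      (t := (T \ G.componentIn T a).card) hy) hκ.le) (mul_pos hp1 hp2).le
  rw [← componentIn_union_sdiff G T a]
  refine (ih _ hC1 ?_).union (ih _ hC2 ?_) Finset.disjoint_sdiff not_adj_componentIn_sdiff ?_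
  · refine mul_right_cancel₀ hp2.ne' (le_antisymm h3 ?_)
    linarith
  · refine mul_left_cancel₀ hp1.ne' (le_antisymm h4 ?_)
    linarith
  · rintro ⟨ho1, ho2⟩
    have h6 := mul_lt_mul_of_pos_right (mul_lt_mul_of_pos_left
      (parityWeight_add_lt hy ho1 ho2) hκ) (mul_pos hp1 hp2)
    linarith

theorem IsTight.exists_adj (hG : G.IsOddCycleGraph) (hy : 1 < y)
    (hT : parityWeight y T.card ≤ y - 1) (hne : T.Nonempty) (h : G.IsTight y v T) :
    ∃ a ∈ T, G.Adj v a := by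
  by_contra! hcon
  have : T.filter (G.Adj v) = ∅ := by
    rw [Finset.filter_eq_empty_iff]
    exact fun z hz => hcon z hz
  rw [IsTight, neighborSum, this, Finset.sum_empty] at h
  have h1 := parityWeight_strictMono hy hne.card_pos
  rw [parityWeight_zero] at h1
  have := mul_pos (mul_pos (div_pos (by linarith) (by linarith) : 0 < y / (y - 1)) h1)
    (isBalanced hG hy T hT).1
  linarith

/-- Strictly below the critical weight, the bounds for connected sets are strict beyond two
vertices, so every component is a vertex or an edge joined completely to `v`. -/
theorem IsTight.isFanOver_of_lt (hG : G.IsOddCycleGraph) (hy : 1 < y)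
    (hT : parityWeight y T.card < y - 1) (hv : v ∉ T) (h : G.IsTight y v T) :
    G.IsFanOver v T := by
  induction T using Finset.strongInduction with
  | H T ih =>
    have hw : ∀ S ⊂ T, parityWeight y S.card < y - 1 := fun S hS =>
      ((parityWeight_strictMono hy).monotone (Finset.card_le_card hS.1)).trans_lt hT
    rcases T.eq_empty_or_nonempty with rfl | hne
    · exact isFanOver_empty
    · obtain ⟨a, ha, hva⟩ := h.exists_adj hG hy hT.le hne
      by_cases hC : G.componentIn T a = T
      · have hconn : ∀ z ∈ T, G.ReachableIn T a z :=
          fun z hz => mem_componentIn.1 (hC.symm ▸ hz)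
        obtain ⟨h1, h2⟩ := (neighborSum_le_of_connected hG hy hT.le ha hv hva hconn
          fun S hS => isBalanced hG hy S (hw S hS).le).2 hT h
        exact isFanOver_of_connected ha hconn h1 h2
      · exact h.isFanOver_of_split hG hy hT.le hv ha hC
          fun S hS => ih S hS (hw S hS) fun h => hv (hS.1 h)

/-- At the critical weight a disconnected `T` reduces to proper subsets, whose weights are smaller.
If `T` is connected, `v` has degree at most two, and maximality passes this to all vertices; that is
strong enough to replace the lost strictness. -/
theorem IsTight.isFanOver_of_max_degree (hG : G.IsOddCycleGraph) (hy : 1 < y)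
    (hT : parityWeight y T.card ≤ y - 1) (hv : v ∉ T) (huniv : ∀ z, z ≠ v → z ∈ T)
    (hdeg : ∀ u, (Finset.univ.filter (G.Adj u)).card ≤ (Finset.univ.filter (G.Adj v)).card)
    (h : G.IsTight y v T) : G.IsFanOver v T := by
  rcases T.eq_empty_or_nonempty with rfl | hne
  · exact isFanOver_empty
  have hw : ∀ S ⊂ T, parityWeight y S.card < y - 1 := fun S hS =>
    (parityWeight_strictMono hy (Finset.card_lt_card hS)).trans_le hT
  have hpos := (isBalanced hG hy T hT).1
  obtain ⟨a, ha, hva⟩ := h.exists_adj hG hy hT hne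
  by_cases hC : G.componentIn T a = T
  swap
  · exact h.isFanOver_of_split hG hy hT hv ha hC fun S hS h' =>
      h'.isFanOver_of_lt hG hy (hw S hS) fun h => hv (hS.1 h)
  have hconn : ∀ z ∈ T, G.ReachableIn T a z := fun z hz => mem_componentIn.1 (hC.symm ▸ hz)
  have hvfil : ∀ z, G.Adj v z → z ∈ T := fun z hz => huniv z hz.ne'
  by_cases hb : ∃ b ∈ T, b ≠ a ∧ G.Adj v b
  · obtain ⟨b, hb, hba, hvb⟩ := hb
    have hab := hba.symm
    have hfil' : Finset.univ.filter (G.Adj v) = {a, b} := by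
      ext z
      simp only [Finset.mem_filter, Finset.mem_insert, Finset.mem_singleton, Finset.mem_univ,
        true_and]
      constructor
      · intro hvz
        by_contra! hne
        exact hG.not_three_neighbors hv hva hvb hvz hab hne.1.symm hne.2.symm (hconn b hb)
          (hconn z (hvfil z hvz))
      · rintro (rfl | rfl)
        exacts [hva, hvb]
    have hfil : T.filter (G.Adj v) = {a, b} := by
      rw [← hfil']
      ext z
      simp only [Finset.mem_filter, Finset.mem_univ, true_and, and_iff_right_iff_imp]
      exact hvfil z
    rw [hfil', Finset.card_pair hab] at hdeg
    have hone : ∀ c, G.Adj v c → ∀ p ∈ T.erase c, ∀ q ∈ T.erase c, G.Adj c p → G.Adj c q →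
        p = q := by
      intro c hvc p hp q hq hcp hcq
      by_contra hpq
      have hp := Finset.mem_of_mem_erase hp
      have hq := Finset.mem_of_mem_erase hq
      have hsub : ({v, p, q} : Finset V) ⊆ Finset.univ.filter (G.Adj c) := by
        intro z hz
        simp only [Finset.mem_insert, Finset.mem_singleton] at hz
        rcases hz with rfl | rfl | rfl <;> simp [hvc.symm, hcp, hcq]
      have := (Finset.card_le_card hsub).trans (hdeg c)
      rw [Finset.card_eq_three.2 ⟨v, p, q, fun h => hv (h ▸ hp), fun h => hv (h ▸ hq), hpq, rfl⟩]
        at this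
      lia
    have h2 : 2 ≤ T.card := by
      rw [← Finset.card_pair hab, ← hfil]
      exact Finset.card_filter_le _ _
    have hσ : parityWeight y (T.card - 1 - 1) + 2 = parityWeight y T.card := by
      rw [← parityWeight_add_two]; congr 1; lia
    have hbound : ∀ c ∈ T, G.Adj v c → G.matchingSum (-1 / y) (T.erase c) ≤
        chordBound y (parityWeight y T.card) 0 * G.matchingSum (-1 / y) T := by
      intro c hc hvc
      -- Since `c` has degree at most two and is adjacent to `v`, it has at most one neighbour in
      -- all of `T - c`. So nothing need be split off and the bound holds with `u = 0`; then `u + u'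
      -- = 0` lies strictly below `σ - 2` once `σ > 2`.
      refine erase_le_chordBound (D := T.erase c) (K := ∅) hy hT hc
        (fun S hS => isBalanced hG hy S (hw S hS).le) ?_ (by simp) (by simp) (by simp)
        (hone c hvc) le_rfl (by simp [neighborSum]) ?_
      · rw [← Finset.card_pos, Finset.card_erase_of_mem hc]; lia
      · rw [Finset.card_erase_of_mem hc, ← hσ]; linarith
    have hle : T.card ≤ 2 := by
      by_contra! hlt
      have h7 := parityWeight_strictMono hy hlt
      rw [parityWeight_of_even (by decide)] at h7
      push_cast at h7
      have h8 := (chordBound_add_le (u := 0) (u' := 0) hy hT h7.le (by linarith)).2 h7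
        (.inr (by linarith))
      have h9 := mul_lt_mul_of_pos_right h8 hpos
      rw [IsTight, neighborSum, hfil, Finset.sum_pair hab] at h
      have := hbound a ha hva
      have := hbound b hb hvb
      linarith
    refine isFanOver_of_connected ha hconn hle fun z hz => ?_
    have : T.filter (G.Adj v) = T := by
      refine Finset.eq_of_subset_of_card_le (Finset.filter_subset _ _) ?_
      rw [hfil, Finset.card_pair hab]; exact hle
    rw [← this] at hz
    exact (Finset.mem_filter.1 hz).2
  · push Not at hb
    have hfil : Finset.univ.filter (G.Adj v) = {a} := by
      ext z
      simp only [Finset.mem_filter, Finset.mem_singleton, Finset.mem_univ, true_and]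
      constructor
      · intro hvz
        by_contra hne
        exact hb z (hvfil z hvz) hne hvz
      · rintro rfl
        exact hva
    -- Otherwise the only neighbour `a` of `v` has a second neighbour in the connected set `T`, and
    -- its degree exceeds the maximum.
    have hle : T.card ≤ 1 := by
      by_contra! hlt
      obtain ⟨z, hz, hza⟩ := Finset.exists_mem_ne hlt a
      obtain ⟨w, hw, haw⟩ := (hconn z hz).exists_adj hza.symm
      have hsub : ({v, w} : Finset V) ⊆ Finset.univ.filter (G.Adj a) := by
        intro z hz
        simp only [Finset.mem_insert, Finset.mem_singleton] at hz
        rcases hz with rfl | rfl <;> simp [hva.symm, haw]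
      have := (Finset.card_le_card hsub).trans (hdeg a)
      rw [hfil, Finset.card_pair fun h : v = w => hv (h ▸ hw)] at this
      simp at this
    refine isFanOver_of_connected ha hconn (by lia) fun z hz => ?_
    rwa [Finset.card_le_one.1 hle z hz a ha]

/-- The matching sum of a fan is the extreme one: the converse of tightness. -/
theorem IsFanOver.isTight (hG : G.IsOddCycleGraph) (hy : 1 < y) (hv : v ∉ T)
    (h : G.IsFanOver v T) : G.IsTight y v T := by
  have hcard : ∀ u ∈ T, (T.filter (G.Adj u)).card ≤ 1 := by
    intro u hu
    rw [Finset.card_le_one]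
    intro p hp q hq
    rw [Finset.mem_filter] at hp hq
    by_contra hpq
    have hvT : ∀ {z}, z ∈ T → z ≠ v := fun hz h => hv (h ▸ hz)
    refine hG.not_three_neighbors (D := {v, p, q}) (a := u) (p := v) (q := p) (r := q) ?_
      (h.1 u hu).symm hp.2 hq.2 (hvT hp.1).symm (hvT hq.1).symm hpq
      (.of_adj (h.1 p hp.1) (by simp) (by simp)) (.of_adj (h.1 q hq.1) (by simp) (by simp))
    simp only [Finset.mem_insert, Finset.mem_singleton, not_or]
    exact ⟨hvT hu, hp.2.ne, hq.2.ne⟩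
  -- Deleting an isolated vertex does not change `L`. For an isolated edge `uw` of `T`, `L(T) = (1 -
  -- 1 / y) * L(T - u)`, since `w` becomes isolated in `T - u`.
  have hval : ∀ u ∈ T, G.matchingSum (-1 / y) (T.erase u) =
      (if ∀ w ∈ T, ¬ G.Adj u w then 1 else y / (y - 1)) * G.matchingSum (-1 / y) T := by
    intro u hu
    have hrec := matchingSum_eq_sub (G := G) (y := y) hu
    have hTu : ((T.erase u).filter (G.Adj u)) = T.filter (G.Adj u) := by
      ext z
      simp only [Finset.mem_filter, Finset.mem_erase]
      exact ⟨fun h => ⟨h.1.2, h.2⟩, fun h => ⟨⟨h.2.ne', h.1⟩, h.2⟩⟩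
    rw [neighborSum, hTu] at hrec
    split_ifs with hiso
    · have : T.filter (G.Adj u) = ∅ := by
        rw [Finset.filter_eq_empty_iff]
        exact fun z hz => hiso z hz
      rw [this, Finset.sum_empty] at hrec
      linarith
    · push Not at hiso
      obtain ⟨w, hw, huw⟩ := hiso
      have hfw : ∀ u ∈ T, ∀ w ∈ T, G.Adj u w → T.filter (G.Adj u) = {w} := by
        intro u hu w hw huw
        refine Finset.eq_singleton_iff_unique_mem.2 ⟨Finset.mem_filter.2 ⟨hw, huw⟩, fun q hq => ?_⟩
        exact Finset.card_le_one.1 (hcard u hu) q hq w (Finset.mem_filter.2 ⟨hw, huw⟩)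
      rw [hfw u hu w hw huw, Finset.sum_singleton] at hrec
      have hw' : w ∈ T.erase u := Finset.mem_erase.2 ⟨huw.ne', hw⟩
      have hrec' := matchingSum_eq_sub (G := G) (y := y) hw'
      have : ((T.erase u).erase w).filter (G.Adj w) = ∅ := by
        rw [Finset.filter_eq_empty_iff]
        intro z hz hwz
        have hzT := Finset.mem_of_mem_erase (Finset.mem_of_mem_erase hz)
        have : z ∈ T.filter (G.Adj w) := Finset.mem_filter.2 ⟨hzT, hwz⟩
        rw [hfw w hw u hu huw.symm, Finset.mem_singleton] at this
        subst this
        simp at hz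
      rw [neighborSum, this, Finset.sum_empty] at hrec'
      have hy1 : y - 1 ≠ 0 := by linarith
      have hy0 : y ≠ 0 := by linarith
      rw [hrec]
      rw [mul_zero, sub_zero] at hrec'
      rw [← hrec']
      field_simp
  rw [IsTight, neighborSum, Finset.filter_true_of_mem h.1, Finset.sum_congr rfl hval,
    ← Finset.sum_mul]
  congr 1
  have hy1 : y - 1 ≠ 0 := by linarith
  have hy0 : y ≠ 0 := by linarith
  have hsum := Finset.card_filter_add_card_filter_not (s := T) (fun u => ∀ w ∈ T, ¬ G.Adj u w)
  have hiso : (T.filter fun u => ∀ w ∈ T, ¬ G.Adj u w).card = T.card % 2 := by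
    rw [← h.2]
    congr 1
    ext u
    simp [mem_isolatedIn]
  rw [Finset.sum_ite, Finset.sum_const, Finset.sum_const, hiso]
  rw [hiso] at hsum
  rcases Nat.even_or_odd T.card with hev | hod
  · rw [parityWeight_of_even hev]
    rw [Nat.even_iff.1 hev, zero_add] at hsum
    rw [hsum, Nat.even_iff.1 hev]
    simp [mul_comm]
  · rw [parityWeight_of_odd hod]
    rw [Nat.odd_iff.1 hod] at hsum ⊢
    rw [← hsum]
    push_cast
    simp only [nsmul_eq_mul, Nat.cast_one]
    field_simp
    ring

end

end SimpleGraph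

/-! ### The critical value of `y` and the extremal root. -/

namespace SimpleGraph

theorem exists_parityWeight_eq {n : ℕ} (hn : 3 ≤ n) : ∃ y₀ : ℝ, 1 < y₀ ∧
    parityWeight y₀ (n - 1) = y₀ - 1 ∧ ∀ y, y₀ < y → parityWeight y (n - 1) < y - 1 := by
  obtain ⟨k, rfl⟩ := Nat.exists_eq_add_of_le' (by lia : 1 ≤ n)
  rw [Nat.add_sub_cancel]
  have hk : (2 : ℝ) ≤ k := by exact_mod_cast (by lia : 2 ≤ k)
  rcases Nat.even_or_odd k with h | h
  · exact ⟨k + 1, by linarith, by rw [parityWeight_of_even h]; ring,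
      fun y hy => by rw [parityWeight_of_even h]; linarith⟩
  -- For odd `k` the equation `k - 1 / y = y - 1` is `y ^ 2 - (k + 1) * y + 1 = 0`, and `y₀` is its
  -- larger root.
  · set r := √(((k : ℝ) + 1) ^ 2 - 4) with hr
    have hr0 : 0 ≤ r := Real.sqrt_nonneg _
    have hr2 : r ^ 2 = ((k : ℝ) + 1) ^ 2 - 4 := Real.sq_sqrt (by nlinarith)
    have key : ∀ y : ℝ, 0 < y → y - 1 - (k - 1 / y) = (y ^ 2 - (k + 1) * y + 1) / y := by
      intro y hy; field_simp; ring
    refine ⟨((k : ℝ) + 1 + r) / 2, by linarith, ?_, fun y hy => ?_⟩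
    · rw [parityWeight_of_odd h, eq_comm, ← sub_eq_zero, key _ (by linarith)]
      rw [div_eq_zero_iff]
      left
      linear_combination hr2 / 4
    · rw [parityWeight_of_odd h, ← sub_pos, key _ (by linarith)]
      refine div_pos ?_ (by linarith)
      have : 0 < (y - (k + 1 + r) / 2) * (y - (k + 1 - r) / 2) :=
        mul_pos (by linarith) (by linarith)
      linear_combination this - hr2 / 4

section

open Classical

variable {V : Type*} [Fintype V] {G : SimpleGraph V}

/-- Some vertex of `G` is adjacent to all others, and these induce a matching that leaves at most
one of them uncovered. -/
def IsFan (G : SimpleGraph V) : Prop := ∃ v, G.IsFanOver v (Finset.univ.erase v)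

theorem isRoot_matchingPoly_iff {x : ℝ} (hx : x ≠ 0) :
    G.matchingPoly.IsRoot x ↔ G.matchingSum (-1 / x ^ 2) Finset.univ = 0 := by
  rw [Polynomial.IsRoot.def, eval_matchingPoly hx, mul_eq_zero_iff_left (pow_ne_zero _ hx)]

theorem roots_le_of_matchingSum {y₀ : ℝ} (h0 : 0 < y₀)
    (h1 : ∀ y, y₀ < y → G.matchingSum (-1 / y) Finset.univ ≠ 0)
    (h2 : G.matchingSum (-1 / y₀) Finset.univ = 0 ↔ G.IsFan) :
    (∀ x, G.matchingPoly.IsRoot x → x ≤ √y₀) ∧ (G.matchingPoly.IsRoot (√y₀) ↔ G.IsFan) := by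
  have hs : 0 < √y₀ := Real.sqrt_pos.2 h0
  refine ⟨fun x hx => ?_, ?_⟩
  · by_contra! hlt
    rw [isRoot_matchingPoly_iff (hs.trans hlt).ne'] at hx
    exact h1 _ (Real.lt_sq_of_sqrt_lt hlt) hx
  · rw [isRoot_matchingPoly_iff hs.ne', Real.sq_sqrt h0.le, h2]

theorem matchingSum_univ_pos (hG : G.IsOddCycleGraph) {y : ℝ} (hy : 1 < y) [Nonempty V]
    (h : parityWeight y (Fintype.card V - 1) < y - 1) :
    0 < G.matchingSum (-1 / y) Finset.univ := by
  obtain ⟨v⟩ := ‹Nonempty V›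
  have hv := Finset.mem_univ v
  have hb := isBalanced hG hy (Finset.univ.erase v) (by
    rw [Finset.card_erase_of_mem hv, Finset.card_univ]; exact h.le)
  refine (mul_pos hb.1 ?_).trans_le (hb.erase_mul_le hy hv)
  rw [Finset.card_univ, sub_pos, div_lt_one (by linarith)]
  exact h

/-- At the critical `y` the factor `y / (y - 1) * w(n - 1)` is simply `y`, so the tight case is the
vanishing of the recurrence at `v`. The vertex `v` is arbitrary, so it may be chosen later. -/
theorem matchingSum_univ_eq_zero_iff_isTight {y : ℝ} (hy : 1 < y) (v : V)
    (h : parityWeight y (Fintype.card V - 1) = y - 1) :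
    G.matchingSum (-1 / y) Finset.univ = 0 ↔ G.IsTight y v (Finset.univ.erase v) := by
  have hv := Finset.mem_univ v
  rw [matchingSum_eq_sub hv, IsTight, Finset.card_erase_of_mem hv, Finset.card_univ, h]
  have hy1 : y - 1 ≠ 0 := by linarith
  have hy0 : y ≠ 0 := by linarith
  rw [div_mul_cancel₀ _ hy1, sub_eq_zero, eq_comm, one_div, inv_mul_eq_iff_eq_mul₀ hy0]

theorem matchingSum_univ_eq_zero_iff (hG : G.IsOddCycleGraph) {y : ℝ} (hy : 1 < y) [Nonempty V]
    (h : parityWeight y (Fintype.card V - 1) = y - 1) :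
    G.matchingSum (-1 / y) Finset.univ = 0 ↔ G.IsFan := by
  constructor
  · intro h0
    obtain ⟨v, -, hv⟩ := Finset.exists_max_image Finset.univ
      (fun u => (Finset.univ.filter (G.Adj u)).card) Finset.univ_nonempty
    have hle : parityWeight y (Finset.univ.erase v).card ≤ y - 1 := by
      rw [Finset.card_erase_of_mem (Finset.mem_univ v), Finset.card_univ, h]
    exact ⟨v, ((matchingSum_univ_eq_zero_iff_isTight hy v h).1 h0).isFanOver_of_max_degree hG hy
      hle (by simp) (by simp) fun u => hv u (Finset.mem_univ u)⟩
  · rintro ⟨v, hv⟩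
    exact (matchingSum_univ_eq_zero_iff_isTight hy v h).2 (hv.isTight hG hy (by simp))

theorem matchingSum_singleton (c : ℝ) (b : V) : G.matchingSum c {b} = 1 := by
  rw [matchingSum_erase c (Finset.mem_singleton_self b)]
  simp

/-- The greatest matching root of the odd-cycle graphs of order `n`. -/
noncomputable def extremalRoot (n : ℕ) : ℝ :=
  -- For `n = 2` the critical equation has the double root `y = 1`, which the estimates for `1 < y`
  -- do not reach; for `n = 1` the matching polynomial is `X`.
  if h : 3 ≤ n then √(exists_parityWeight_eq h).choose else if n = 2 then √1 else 0

theorem IsOddCycleGraph.root_le_extremalRoot [Nonempty V] (hG : G.IsOddCycleGraph) :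
    (∀ x, G.matchingPoly.IsRoot x → x ≤ extremalRoot (Fintype.card V)) ∧
      (G.matchingPoly.IsRoot (extremalRoot (Fintype.card V)) ↔ G.IsFan) := by
  have hn : 0 < Fintype.card V := Fintype.card_pos
  rcases (by lia : Fintype.card V = 1 ∨ Fintype.card V = 2 ∨ 3 ≤ Fintype.card V)
    with hV | hV | h3
  · rw [show extremalRoot (Fintype.card V) = 0 by simp [extremalRoot, hV]]
    obtain ⟨v, hv⟩ := Fintype.card_eq_one_iff.1 hV
    have huniv : (Finset.univ : Finset V) = {v} := by ext z; simp [hv z]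
    have hX : ∀ x, G.matchingPoly.eval x = x := by
      intro x
      have := aeval_matchingPoly (G := G) x
      rw [Polynomial.coe_aeval_eq_eval] at this
      rw [this, hV, sum_matchingsWithin_univ (fun k => (-1) ^ k * x ^ (1 - 2 * k)), hV]
      have h0 : G.matchings 0 = {∅} := by
        ext M
        rw [mem_matchings, Finset.card_eq_zero, Finset.mem_singleton, and_iff_right_iff_imp]
        rintro rfl
        exact ⟨by simp, by simp⟩
      simp [h0]
    simp only [Polynomial.IsRoot.def, hX]
    refine ⟨fun x hx => hx.le, iff_of_true trivial ⟨v, ?_⟩⟩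
    rw [huniv, Finset.erase_singleton]
    exact isFanOver_empty
  · rw [show extremalRoot (Fintype.card V) = √1 by simp [extremalRoot, hV]]
    obtain ⟨a, b, hab, huniv⟩ := Finset.card_eq_two.1 (Finset.card_univ.trans hV)
    have hea : (Finset.univ : Finset V).erase a = {b} := by
      rw [huniv, Finset.erase_insert (by simpa using hab)]
    have hsum : ∀ y : ℝ, G.matchingSum (-1 / y) Finset.univ =
        1 - 1 / y * if G.Adj a b then 1 else 0 := by
      intro y
      rw [matchingSum_eq_sub (Finset.mem_univ a), hea, matchingSum_singleton, neighborSum,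
        Finset.filter_singleton]
      split_ifs <;> simp
    refine roots_le_of_matchingSum one_pos (fun y hy => ?_) ?_
    · rw [hsum]
      have : 1 / y < 1 := by rw [div_lt_one (by linarith)]; exact hy
      split_ifs
      · rw [mul_one]; linarith
      · simp
    · rw [hsum]
      constructor
      · intro h
        have hadj : G.Adj a b := by
          by_contra hcon
          simp [hcon] at h
        refine ⟨a, ?_⟩
        rw [hea]
        exact isFanOver_of_connected (Finset.mem_singleton_self b)
          (by simpa using .refl (by simp)) (by simp) (by simpa using hadj)
      · rintro ⟨v, hv, -⟩
        have hadj : G.Adj a b := by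
          rcases eq_or_ne v a with rfl | hva
          · exact hv b (by simp [hab.symm])
          · have hvb : v = b := by
              have := Finset.mem_univ v
              rw [huniv] at this
              simpa [hva] using this
            subst hvb
            exact (hv a (by simp [hab])).symm
        simp [hadj]
  · obtain ⟨h1, h2, h4⟩ := (exists_parityWeight_eq h3).choose_spec
    rw [extremalRoot, dif_pos h3]
    exact roots_le_of_matchingSum (by linarith)
      (fun y hy => (matchingSum_univ_pos hG (h1.trans hy) (h4 y hy)).ne')
      (matchingSum_univ_eq_zero_iff hG h1 h2)

end

end SimpleGraph

/-! ### Reversing a cycle of a permutation, and cancellation in the determinant. -/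

theorem Equiv.Perm.sameCycle_inv_apply_right' {V : Type*} {π : Equiv.Perm V} {v w : V} :
    π.SameCycle v (π⁻¹ w) ↔ π.SameCycle v w :=
  Equiv.Perm.sameCycle_symm_apply_right

theorem Equiv.Perm.commute_cycleOf {V : Type*} (π : Equiv.Perm V) [DecidableRel π.SameCycle]
    (v : V) : Commute π (π.cycleOf v) := by
  ext w
  rw [Equiv.Perm.mul_apply, Equiv.Perm.mul_apply, Equiv.Perm.cycleOf_apply,
    Equiv.Perm.cycleOf_apply]
  simp only [Equiv.Perm.sameCycle_apply_right]
  split_ifs <;> rfl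

theorem Equiv.Perm.cycleOf_inv_apply_ite {V : Type*} (π : Equiv.Perm V)
    [DecidableRel π.SameCycle] (v w : V) :
    (π.cycleOf v)⁻¹ w = if π.SameCycle v w then π⁻¹ w else w := by
  rw [Equiv.Perm.inv_eq_iff_eq]
  split_ifs with h
  · rw [Equiv.Perm.cycleOf_apply, if_pos (Equiv.Perm.sameCycle_inv_apply_right'.2 h)]
    simp
  · rw [Equiv.Perm.cycleOf_apply, if_neg h]

namespace SimpleGraph

open Classical

/-- The permutation `π` with the cycle of `v` reversed. -/
noncomputable def reverseCycle {V : Type*} (π : Equiv.Perm V) (v : V) : Equiv.Perm V :=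
  π * (π.cycleOf v)⁻¹ * (π.cycleOf v)⁻¹

section reverseCycle

variable {V : Type*} (π : Equiv.Perm V) (v : V)

theorem reverseCycle_apply (w : V) :
    reverseCycle π v w = if π.SameCycle v w then π⁻¹ w else π w := by
  rw [reverseCycle, Equiv.Perm.mul_apply, Equiv.Perm.mul_apply, π.cycleOf_inv_apply_ite v w]
  split_ifs with h
  · rw [π.cycleOf_inv_apply_ite, if_pos (Equiv.Perm.sameCycle_inv_apply_right'.2 h)]
    simp
  · rw [π.cycleOf_inv_apply_ite, if_neg h]

theorem reverseCycle_reverseCycle (hv : π v ≠ v) : reverseCycle (reverseCycle π v) v = π := by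
  have hc : π.cycleOf v v ≠ v := by simpa using hv
  have h1 : (reverseCycle π v).cycleOf v = (π.cycleOf v)⁻¹ := by
    have hcomm : Commute (π.cycleOf v)⁻¹ (π * (π.cycleOf v)⁻¹) :=
      (Commute.mul_right (π.commute_cycleOf v).symm.inv_left (Commute.refl _))
    -- The second factor fixes `v` and commutes with the first, so the cycle of `v` in the product
    -- is the inverse cycle.
    have e : reverseCycle π v = (π.cycleOf v)⁻¹ * (π * (π.cycleOf v)⁻¹) := hcomm.eq.symm
    rw [e, Equiv.Perm.cycleOf_mul_of_apply_right_eq_self hcomm v (by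
      rw [Equiv.Perm.mul_apply, π.cycleOf_inv_apply_ite, if_pos (Equiv.Perm.SameCycle.refl _ _)]
      simp)]
    rw [← Equiv.Perm.cycleOf_inv, (π.isCycle_cycleOf hv).cycleOf_eq hc]
  rw [reverseCycle, h1, reverseCycle]
  simp

theorem reverseCycle_sq_apply_eq_iff (w : V) :
    reverseCycle π v (reverseCycle π v w) = w ↔ π (π w) = w := by
  rw [reverseCycle_apply π v w]
  split_ifs with h
  · rw [reverseCycle_apply, if_pos (Equiv.Perm.sameCycle_inv_apply_right'.2 h),
      Equiv.Perm.inv_eq_iff_eq, Equiv.Perm.inv_eq_iff_eq, eq_comm]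
  · rw [reverseCycle_apply, if_neg (mt Equiv.Perm.sameCycle_apply_right.1 h)]

end reverseCycle

variable {V : Type*} {G : SimpleGraph V}

theorem IsOddCycleGraph.odd_of_cyclic (hG : G.IsOddCycleGraph) (f : ℕ → V) {m : ℕ} (hm : 3 ≤ m)
    (hinj : Set.InjOn f (Set.Iio m)) (hadj : ∀ i, i + 1 < m → G.Adj (f i) (f (i + 1)))
    (hclose : G.Adj (f (m - 1)) (f 0)) : Odd m := by
  have key : ∀ k < m, ∃ p : G.Walk (f 0) (f k), p.IsPath ∧ p.length = k ∧
      ∀ z ∈ p.support, ∃ i ≤ k, z = f i := by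
    intro k
    induction k with
    | zero => exact fun _ => ⟨.nil, by simp, by simp, by simp⟩
    | succ k ih =>
      intro hk
      obtain ⟨p, hp, hlen, hsupp⟩ := ih (by lia)
      refine ⟨p.concat (hadj k hk), hp.concat (fun h => ?_) _, by simp [hlen], fun z hz => ?_⟩
      · obtain ⟨i, hi, he⟩ := hsupp _ h
        have := hinj (by simpa using hk) (by simp only [Set.mem_Iio]; lia) he
        lia
      · rw [Walk.support_concat, List.mem_append] at hz
        rcases hz with hz | hz
        · obtain ⟨i, hi, he⟩ := hsupp z hz
          exact ⟨i, by lia, he⟩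
        · exact ⟨k + 1, le_rfl, by simpa using hz⟩
  obtain ⟨p, hp, hlen, -⟩ := key (m - 1) (by lia)
  have hcyc : (Walk.cons hclose p).IsCycle := by
    rw [Walk.isCycle_iff_isPath_tail_and_le_length]
    refine ⟨by simpa using hp, ?_⟩
    simp only [Walk.length_cons]
    lia
  have := hG _ _ hcyc
  rw [Walk.length_cons, hlen] at this
  convert this using 1
  lia

variable [Fintype V]

/-- Because `π (π v) ≠ v`, the orbit has at least three points, and following `π` around it traces a
cycle of `G`. -/
theorem IsOddCycleGraph.odd_card_sameCycle (hG : G.IsOddCycleGraph) (π : Equiv.Perm V) {v : V}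
    (hv : π (π v) ≠ v) (hadj : ∀ w, π.SameCycle v w → G.Adj (π w) w) :
    Odd (Finset.univ.filter (π.SameCycle v)).card := by
  have hv1 : π v ≠ v := fun h => hv (by rw [h, h])
  have hcyc := π.isCycle_cycleOf hv1
  have hcv : π.cycleOf v v ≠ v := by simpa using hv1
  have hsupp : Finset.univ.filter (π.SameCycle v) = (π.cycleOf v).support := by
    ext w
    simp only [Finset.mem_filter, Finset.mem_univ, true_and]
    rw [Equiv.Perm.mem_support_cycleOf_iff' hv1]
  have hsame : ∀ i : ℕ, π.SameCycle v ((π ^ i) v) := fun i => ⟨i, by simp⟩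
  have h3 : 3 ≤ (Finset.univ.filter (π.SameCycle v)).card := by
    have hsub : ({v, π v, π (π v)} : Finset V) ⊆ Finset.univ.filter (π.SameCycle v) := by
      intro z hz
      simp only [Finset.mem_insert, Finset.mem_singleton] at hz
      rcases hz with rfl | rfl | rfl <;> simp [Equiv.Perm.SameCycle.refl]
    have hc : ({v, π v, π (π v)} : Finset V).card = 3 :=
      Finset.card_eq_three.2 ⟨v, π v, π (π v), hv1.symm, hv.symm,
        fun h => hv1 (π.injective h).symm, rfl⟩
    rw [← hc]
    exact Finset.card_le_card hsub
  rw [hsupp, ← hcyc.orderOf] at h3 ⊢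
  have hstep : ∀ i : ℕ, π ((π ^ i) v) = (π ^ (i + 1)) v := fun i => by
    rw [pow_succ', Equiv.Perm.mul_apply]
  refine hG.odd_of_cyclic (fun i => (π ^ i) v) h3 ?_ (fun i _ => ?_) ?_
  · have hlt : ∀ i j : ℕ, i < j → j < orderOf (π.cycleOf v) → (π ^ i) v ≠ (π ^ j) v := by
      intro i j hij hj he
      have h1 : (π ^ (j - i)) v = v := by
        apply (π ^ i).injective
        rw [← Equiv.Perm.mul_apply, ← pow_add, he]
        congr 2; lia
      rw [← Equiv.Perm.cycleOf_pow_apply_self, ← hcyc.pow_eq_one_iff' hcv] at h1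
      have := orderOf_le_of_pow_eq_one (by lia) h1
      lia
    intro i hi j hj he
    rcases lt_trichotomy i j with h | h | h
    · exact absurd he (hlt i j h hj)
    · exact h
    · exact absurd he.symm (hlt j i h hi)
  · rw [← hstep]
    exact (hadj _ (hsame i)).symm
  · have h1 : π ((π ^ (orderOf (π.cycleOf v) - 1)) v) = v := by
      rw [hstep, Nat.sub_add_cancel (by lia), ← Equiv.Perm.cycleOf_pow_apply_self,
        pow_orderOf_eq_one, Equiv.Perm.one_apply]
    have h2 := hadj _ (hsame (orderOf (π.cycleOf v) - 1))
    rw [h1] at h2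
    simpa using h2.symm

/-- A matrix supported on the edges of `G` and the diagonal, which is constant; the other entries
are skew-symmetric, and their products with the transposed entries are `1`. -/
structure IsSkewEdgeMatrix (G : SimpleGraph V) {R : Type*} [CommRing R] (z : R)
    (M : Matrix V V R) : Prop where
  diag : ∀ v, M v v = z
  neg : ∀ u v, u ≠ v → M u v = - M v u
  zero : ∀ u v, u ≠ v → ¬ G.Adj u v → M u v = 0
  mul : ∀ u v, G.Adj u v → M u v * M v u = 1

section det

variable {R : Type*} [CommRing R] {z : R} {M : Matrix V V R}

/-- Reversal replaces the entries along the cycle by their transposes, which gives one factor `-1`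
per vertex. Either the cycle runs along edges and has odd length, or some entry is zero and both
products vanish. -/
theorem IsSkewEdgeMatrix.prod_reverseCycle (hM : G.IsSkewEdgeMatrix z M) (hG : G.IsOddCycleGraph)
    (π : Equiv.Perm V) {v : V} (hv : π (π v) ≠ v) :
    ∏ w, M (reverseCycle π v w) w = - ∏ w, M (π w) w := by
  rw [← Finset.prod_filter_mul_prod_filter_not Finset.univ (π.SameCycle v),
    ← Finset.prod_filter_mul_prod_filter_not Finset.univ (π.SameCycle v) (fun w => M (π w) w),
    ← neg_mul]
  have hv1 : π v ≠ v := fun h => hv (by rw [h, h])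
  have hne : ∀ w, π.SameCycle v w → π w ≠ w := fun w hw h => hv1 (hw.apply_eq_self_iff.2 h)
  congr 1
  · calc _ = ∏ w ∈ Finset.univ.filter (π.SameCycle v), M w (π w) := by
          refine Finset.prod_equiv π⁻¹ (fun w => by simp) fun w hw => ?_
          rw [reverseCycle_apply, if_pos (Finset.mem_filter.1 hw).2]
          simp
      _ = ∏ w ∈ Finset.univ.filter (π.SameCycle v), (-1) * M (π w) w := by
          refine Finset.prod_congr rfl fun w hw => ?_
          rw [hM.neg _ _ (hne w (Finset.mem_filter.1 hw).2).symm, neg_one_mul]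
      _ = _ := by
          rw [Finset.prod_mul_distrib, Finset.prod_const]
          by_cases hadj : ∀ w, π.SameCycle v w → G.Adj (π w) w
          · rw [(hG.odd_card_sameCycle π hv hadj).neg_one_pow, neg_one_mul]
          · push Not at hadj
            obtain ⟨w, hw, hnadj⟩ := hadj
            have h0 : ∏ w ∈ Finset.univ.filter (π.SameCycle v), M (π w) w = 0 :=
              Finset.prod_eq_zero (Finset.mem_filter.2 ⟨Finset.mem_univ w, hw⟩)
                (hM.zero _ _ (hne w hw) hnadj)
            rw [h0]
            simp
  · refine Finset.prod_congr rfl fun w hw => ?_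
    rw [reverseCycle_apply, if_neg (Finset.mem_filter.1 hw).2]

theorem sign_reverseCycle (π : Equiv.Perm V) (v : V) :
    Equiv.Perm.sign (reverseCycle π v) = Equiv.Perm.sign π := by
  rw [reverseCycle, map_mul, map_mul, mul_assoc, Int.units_mul_self, mul_one]

/-- In the determinant, the permutations that are not involutions cancel. -/
theorem IsSkewEdgeMatrix.det_eq_sum_involutive (hM : G.IsSkewEdgeMatrix z M)
    (hG : G.IsOddCycleGraph) :
    M.det = ∑ π ∈ Finset.univ.filter (fun π : Equiv.Perm V => Function.Involutive (π : V → V)),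
      Equiv.Perm.sign π • ∏ w, M (π w) w := by
  rw [Matrix.det_apply, ← Finset.sum_filter_add_sum_filter_not Finset.univ
    (fun π : Equiv.Perm V => Function.Involutive (π : V → V)), add_eq_left]
  have hex : ∀ π : Equiv.Perm V, π ∈ Finset.univ.filter
      (fun π : Equiv.Perm V => ¬ Function.Involutive (π : V → V)) → ∃ w, π (π w) ≠ w := by
    intro π hπ
    simpa [Function.Involutive] using hπ
  -- The cycle to reverse is chosen through this predicate alone. Reversal preserves the predicate,
  -- so the same vertex is chosen again and the pairing is an involution.
  set pick : Equiv.Perm V → V → Prop := fun π w => π (π w) ≠ w with hpick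
  have hpickrev : ∀ π v, pick (reverseCycle π v) = pick π := fun π v => by
    funext w
    exact propext (not_congr (reverseCycle_sq_apply_eq_iff π v w))
  refine Finset.sum_involution
    (fun π hπ => reverseCycle π (Classical.choose (hex π hπ))) ?_ ?_ ?_ ?_
  · intro π hπ
    rw [sign_reverseCycle, hM.prod_reverseCycle hG π (Classical.choose_spec (hex π hπ)), smul_neg,
      add_neg_cancel]
  · intro π hπ _ he
    have hs := Classical.choose_spec (hex π hπ)
    have := congrArg (fun ρ : Equiv.Perm V => ρ (Classical.choose (hex π hπ))) he
    simp only [reverseCycle_apply, Equiv.Perm.SameCycle.refl, if_true] at this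
    rw [Equiv.Perm.inv_eq_iff_eq] at this
    exact hs this.symm
  · intro π hπ
    obtain ⟨w, hw⟩ := hex π hπ
    rw [Finset.mem_filter]
    refine ⟨Finset.mem_univ _, fun h => ?_⟩
    exact hw ((reverseCycle_sq_apply_eq_iff π _ w).1 (h w))
  · intro π hπ
    have hs := Classical.choose_spec (hex π hπ)
    have hchoose : ∀ (p q : V → Prop) (hp : ∃ w, p w) (hq : ∃ w, q w), p = q →
        Classical.choose hp = Classical.choose hq := by
      rintro p q hp hq rfl; rfl
    have e := hchoose (pick (reverseCycle π (Classical.choose (hex π hπ)))) (pick π)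
      (by rw [hpickrev]; exact hex π hπ) (hex π hπ) (hpickrev _ _)
    refine Eq.trans ?_ (reverseCycle_reverseCycle π (Classical.choose (hex π hπ))
      fun h => hs (by rw [h, h]))
    congr 1

end det

end SimpleGraph

/-! ### Involutions as matchings, and the skew spectrum as the set of matching roots. -/

namespace SimpleGraph

open Classical

variable {V : Type*} {G : SimpleGraph V}

theorem EdgeOrientation.isHermitian (σ : G.EdgeOrientation) :
    (Complex.I • σ.skewMatrix).IsHermitian := by
  ext u v
  simp only [Matrix.conjTranspose_apply, Matrix.smul_apply, skewMatrix, Matrix.of_apply]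
  by_cases h : σ.arc u v
  · simp [h, σ.asymm _ _ h]
  · by_cases h' : σ.arc v u <;> simp [h, h']

variable [Fintype V]

/-- The edges joining the vertices that a permutation moves to their images. -/
noncomputable def orbitEdges (π : Equiv.Perm V) : Finset (Sym2 V) :=
  π.support.image fun w => s(w, π w)

theorem mk_mem_orbitEdges {π : Equiv.Perm V} (hπ : Function.Involutive (π : V → V)) {u v : V} :
    s(u, v) ∈ orbitEdges π ↔ u ≠ v ∧ π u = v := by
  simp only [orbitEdges, Finset.mem_image, Equiv.Perm.mem_support, Sym2.eq_iff]
  constructor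
  · rintro ⟨w, hw, ⟨rfl, rfl⟩ | ⟨rfl, rfl⟩⟩
    · exact ⟨hw.symm, rfl⟩
    · exact ⟨hw, hπ w⟩
  · rintro ⟨hne, rfl⟩
    exact ⟨u, hne.symm, .inl ⟨rfl, rfl⟩⟩

theorem isMatchingSet_orbitEdges {π : Equiv.Perm V} (hπ : Function.Involutive (π : V → V))
    (hadj : ∀ w, π w ≠ w → G.Adj (π w) w) : G.IsMatchingSet (orbitEdges π) := by
  have key : ∀ e ∈ orbitEdges π, ∀ v ∈ e, e = s(v, π v) := by
    intro e he v hv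
    obtain ⟨u, rfl⟩ := Sym2.mem_iff_exists.1 hv
    rw [((mk_mem_orbitEdges hπ).1 he).2]
  refine ⟨fun e he => ?_, fun e he f hf v hve hvf => by rw [key e he v hve, key f hf v hvf]⟩
  induction e with
  | h u v =>
    obtain ⟨h1, rfl⟩ := (mk_mem_orbitEdges hπ).1 he
    exact (hadj u h1.symm).symm

theorem filter_support_eq_pair {π : Equiv.Perm V} (hπ : Function.Involutive (π : V → V)) {u : V}
    (hu : u ∈ π.support) :
    π.support.filter (fun w => s(w, π w) = s(u, π u)) = {u, π u} := by
  ext w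
  simp only [Finset.mem_filter, Finset.mem_insert, Finset.mem_singleton, Sym2.eq_iff]
  constructor
  · rintro ⟨-, ⟨h, -⟩ | ⟨h, -⟩⟩
    exacts [.inl h, .inr h]
  · rintro (rfl | rfl)
    · exact ⟨hu, .inl ⟨rfl, rfl⟩⟩
    · exact ⟨Equiv.Perm.apply_mem_support.2 hu, .inr ⟨rfl, hπ u⟩⟩

theorem card_support_eq_two_mul {π : Equiv.Perm V} (hπ : Function.Involutive (π : V → V)) :
    π.support.card = 2 * (orbitEdges π).card := by
  rw [Finset.card_eq_sum_card_image (fun w => s(w, π w)) π.support, ← orbitEdges, mul_comm,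
    ← smul_eq_mul, ← Finset.sum_const]
  refine Finset.sum_congr rfl fun e he => ?_
  obtain ⟨u, hu, rfl⟩ := Finset.mem_image.1 he
  rw [filter_support_eq_pair hπ hu, Finset.card_pair (Equiv.Perm.mem_support.1 hu).symm]

theorem sign_eq_neg_one_pow {π : Equiv.Perm V} (hπ : Function.Involutive (π : V → V)) :
    Equiv.Perm.sign π = (-1) ^ (orbitEdges π).card := by
  have hsq : π ^ 2 = 1 := by
    ext w
    rw [sq, Equiv.Perm.mul_apply, Equiv.Perm.one_apply, hπ w]
  have h1 := Equiv.Perm.cycleType_of_pow_prime_eq_one (p := 2) hsq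
  have h2 := π.sum_cycleType
  have h3 : π.cycleType.sum = 2 * Multiset.card π.cycleType := by
    conv_lhs => rw [h1]
    simp [mul_comm]
  have h4 := card_support_eq_two_mul hπ
  have h5 : Multiset.card π.cycleType = (orbitEdges π).card := by lia
  rw [Equiv.Perm.sign_of_cycleType, h3, h5, pow_add, pow_mul]
  simp

variable {R : Type*} [CommRing R] {z : R} {M : Matrix V V R}

theorem IsSkewEdgeMatrix.prod_eq_pow (hM : G.IsSkewEdgeMatrix z M) {π : Equiv.Perm V}
    (hπ : Function.Involutive (π : V → V)) (hadj : ∀ w, π w ≠ w → G.Adj (π w) w) :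
    ∏ w, M (π w) w = z ^ (Fintype.card V - 2 * (orbitEdges π).card) := by
  rw [← Finset.prod_mul_prod_compl π.support]
  have h1 : ∏ w ∈ π.support, M (π w) w = 1 := by
    rw [← Finset.prod_fiberwise_of_maps_to (t := orbitEdges π) (g := fun w => s(w, π w))
      fun w hw => Finset.mem_image_of_mem _ hw]
    refine Finset.prod_eq_one fun e he => ?_
    obtain ⟨u, hu, rfl⟩ := Finset.mem_image.1 he
    have hne := Equiv.Perm.mem_support.1 hu
    rw [filter_support_eq_pair hπ hu, Finset.prod_pair hne.symm, hπ u]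
    exact hM.mul _ _ (hadj u hne)
  have h2 : ∏ w ∈ π.supportᶜ, M (π w) w = ∏ w ∈ π.supportᶜ, z := by
    refine Finset.prod_congr rfl fun w hw => ?_
    rw [Finset.mem_compl, Equiv.Perm.notMem_support] at hw
    rw [hw, hM.diag]
  rw [h1, h2, one_mul, Finset.prod_const, Finset.card_compl, card_support_eq_two_mul hπ]

/-- Swap the ends of every edge of the matching and fix the remaining vertices. -/
theorem IsMatchingSet.exists_involutive {N : Finset (Sym2 V)} (hN : G.IsMatchingSet N) :
    ∃ π : Equiv.Perm V, Function.Involutive (π : V → V) ∧ (∀ w, π w ≠ w → G.Adj (π w) w) ∧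
      orbitEdges π = N := by
  have huniq : ∀ {v u u'}, s(v, u) ∈ N → s(v, u') ∈ N → u = u' := fun {v u u'} h h' =>
    Sym2.congr_right.1 (hN.2 _ h _ h' v (by simp) (by simp))
  set f : V → V := fun v => if h : ∃ u, s(v, u) ∈ N then h.choose else v with hf
  have hf1 : ∀ {v u}, s(v, u) ∈ N → f v = u := fun {v u} h => by
    have hex : ∃ u, s(v, u) ∈ N := ⟨u, h⟩
    simp only [hf, dif_pos hex]
    exact huniq hex.choose_spec h
  have hf2 : ∀ {v}, f v ≠ v → s(v, f v) ∈ N := fun {v} h => by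
    by_cases hex : ∃ u, s(v, u) ∈ N
    · obtain ⟨u, hu⟩ := hex
      rwa [hf1 hu]
    · exact absurd (by simp only [hf, dif_neg hex]) h
  have hinv : Function.Involutive f := fun v => by
    by_cases h : f v = v
    · rw [h, h]
    · have := hf2 h
      rw [Sym2.eq_swap] at this
      exact hf1 this
  have hinv' : Function.Involutive (hinv.toPerm f : V → V) := hinv
  refine ⟨hinv.toPerm f, hinv', fun w hw => ?_, ?_⟩
  · exact (hN.1 _ (hf2 hw) : G.Adj w (f w)).symm
  · ext e
    induction e with
    | h u v =>
      rw [mk_mem_orbitEdges hinv']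
      constructor
      · rintro ⟨hne, he⟩
        have he : f u = v := he
        rw [← he]
        exact hf2 (he ▸ hne.symm)
      · intro h
        exact ⟨(hN.1 _ h : G.Adj u v).ne, hf1 h⟩

theorem IsSkewEdgeMatrix.det_eq (hM : G.IsSkewEdgeMatrix z M) (hG : G.IsOddCycleGraph) :
    M.det = ∑ N ∈ G.matchingsWithin Finset.univ,
      (-1) ^ N.card * z ^ (Fintype.card V - 2 * N.card) := by
  rw [hM.det_eq_sum_involutive hG, ← Finset.sum_filter_of_ne
    (p := fun π : Equiv.Perm V => ∀ w, π w ≠ w → G.Adj (π w) w)]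
  · refine Finset.sum_bij (fun π _ => orbitEdges π) ?_ ?_ ?_ ?_
    · intro π hπ
      simp only [Finset.mem_filter, Finset.mem_univ, true_and] at hπ
      exact mem_matchingsWithin.2 ⟨isMatchingSet_orbitEdges hπ.1 hπ.2, by simp⟩
    · intro π hπ ρ hρ he
      simp only [Finset.mem_filter, Finset.mem_univ, true_and] at hπ hρ
      have key : ∀ π ρ : Equiv.Perm V, Function.Involutive (π : V → V) →
          Function.Involutive (ρ : V → V) → orbitEdges π = orbitEdges ρ →
          ∀ w, π w ≠ w → ρ w = π w := by
        intro π ρ hπ hρ he w hw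
        have : s(w, π w) ∈ orbitEdges π := (mk_mem_orbitEdges hπ).2 ⟨hw.symm, rfl⟩
        rw [he, mk_mem_orbitEdges hρ] at this
        exact this.2
      ext w
      by_cases h : π w = w
      · by_cases h' : ρ w = w
        · rw [h, h']
        · exact key ρ π hρ.1 hπ.1 he.symm w h'
      · exact (key π ρ hπ.1 hρ.1 he w h).symm
    · intro N hN
      obtain ⟨π, h1, h2, h3⟩ := (mem_matchingsWithin.1 hN).1.exists_involutive
      exact ⟨π, by simpa using ⟨h1, h2⟩, h3⟩
    · intro π hπ
      simp only [Finset.mem_filter, Finset.mem_univ, true_and] at hπ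
      rw [sign_eq_neg_one_pow hπ.1, hM.prod_eq_pow hπ.1 hπ.2, Units.smul_def]
      simp
  · intro π _ hne w hw
    by_contra hnadj
    have h0 : ∏ w, M (π w) w = 0 := Finset.prod_eq_zero (Finset.mem_univ w) (hM.zero _ _ hw hnadj)
    exact hne (by rw [h0, smul_zero])

/-- The factor `i` turns the product `-1` of opposite skew entries into `1`, so the determinant no
longer sees the orientation. -/
theorem EdgeOrientation.isSkewEdgeMatrix (σ : G.EdgeOrientation) (z : ℂ) :
    G.IsSkewEdgeMatrix z (Matrix.scalar V z - Complex.I • σ.skewMatrix) where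
  diag v := by
    have h : ¬ σ.arc v v := fun h => σ.asymm v v h h
    simp [skewMatrix, h]
  neg u v huv := by
    simp only [Matrix.sub_apply, Matrix.scalar_apply, Matrix.diagonal_apply_ne _ huv,
      Matrix.diagonal_apply_ne _ huv.symm, Matrix.smul_apply, skewMatrix, Matrix.of_apply]
    by_cases h : σ.arc u v
    · simp [h, σ.asymm _ _ h]
    · by_cases h' : σ.arc v u <;> simp [h, h']
  zero u v huv h := by
    rw [σ.adj_iff, not_or] at h
    simp [skewMatrix, Matrix.diagonal_apply_ne _ huv, h.1, h.2]
  mul u v h := by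
    simp only [Matrix.sub_apply, Matrix.scalar_apply, Matrix.diagonal_apply_ne _ h.ne,
      Matrix.diagonal_apply_ne _ h.ne', Matrix.smul_apply, skewMatrix, Matrix.of_apply]
    rcases (σ.adj_iff u v).1 h with h | h <;> simp [h, σ.asymm _ _ h]

theorem EdgeOrientation.det_eq_aeval (σ : G.EdgeOrientation) (hG : G.IsOddCycleGraph) (z : ℂ) :
    (Matrix.scalar V z - Complex.I • σ.skewMatrix).det = aeval z G.matchingPoly := by
  rw [(σ.isSkewEdgeMatrix z).det_eq hG, aeval_matchingPoly]

theorem EdgeOrientation.mem_spectrum_iff (σ : G.EdgeOrientation) (hG : G.IsOddCycleGraph) (z : ℂ) :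
    z ∈ spectrum ℂ (Complex.I • σ.skewMatrix) ↔ aeval z G.matchingPoly = 0 := by
  rw [← σ.det_eq_aeval hG, spectrum.mem_iff, Matrix.isUnit_iff_isUnit_det, isUnit_iff_ne_zero,
    not_not]
  rfl

theorem exists_edgeOrientation (G : SimpleGraph V) : Nonempty G.EdgeOrientation := by
  set e := Fintype.equivFin V
  exact ⟨⟨fun u v => G.Adj u v ∧ e u < e v, fun u v =>
    ⟨fun h => (lt_or_gt_of_ne (e.injective.ne h.ne)).imp (fun h' => ⟨h, h'⟩) fun h' => ⟨h.symm, h'⟩,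
      fun h => h.elim (fun h => h.1) fun h => h.1.symm⟩,
    fun u v h h' => (h.2.trans h'.2).false⟩⟩

theorem aeval_neg_matchingPoly (z : ℂ) :
    aeval (-z) G.matchingPoly = (-1) ^ Fintype.card V * aeval z G.matchingPoly := by
  rw [aeval_matchingPoly, aeval_matchingPoly, Finset.mul_sum]
  refine Finset.sum_congr rfl fun N hN => ?_
  have := (mem_matchingsWithin.1 hN).1.two_mul_card_le
  obtain ⟨k, hk⟩ := Nat.exists_eq_add_of_le this
  rw [hk, Nat.add_sub_cancel_left, neg_pow z, pow_add, pow_mul, neg_one_sq, one_pow]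
  ring

theorem isRoot_iff_aeval {x : ℝ} : G.matchingPoly.IsRoot x ↔ aeval (x : ℂ) G.matchingPoly = 0 := by
  rw [Polynomial.IsRoot.def, ← Polynomial.coe_aeval_eq_eval]
  have h := Polynomial.aeval_algebraMap_apply ℂ x G.matchingPoly
  rw [Complex.coe_algebraMap] at h
  rw [h, Complex.ofReal_eq_zero]

theorem isRoot_neg {x : ℝ} (h : G.matchingPoly.IsRoot x) : G.matchingPoly.IsRoot (-x) := by
  rw [isRoot_iff_aeval] at h ⊢
  rw [Complex.ofReal_neg, aeval_neg_matchingPoly, h, mul_zero]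

/-- The matrix is Hermitian, so every complex root of the matching polynomial is real. This also
gives the existence of real roots. -/
theorem EdgeOrientation.spectrum_eq (σ : G.EdgeOrientation) (hG : G.IsOddCycleGraph) :
    spectrum ℂ (Complex.I • σ.skewMatrix) =
      Complex.ofReal '' {x : ℝ | G.matchingPoly.IsRoot x} := by
  ext z
  constructor
  · intro hz
    have h := hz
    rw [σ.isHermitian.spectrum_eq_image_range] at h
    obtain ⟨x, -, rfl⟩ := h
    exact ⟨x, isRoot_iff_aeval.2 ((σ.mem_spectrum_iff hG _).1 hz), rfl⟩
  · rintro ⟨x, hx, rfl⟩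
    exact (σ.mem_spectrum_iff hG _).2 (isRoot_iff_aeval.1 hx)

theorem IsOddCycleGraph.isGreatest_maxMatchingRoot [Nonempty V] (hG : G.IsOddCycleGraph) :
    IsGreatest {x : ℝ | G.matchingPoly.IsRoot x} G.maxMatchingRoot := by
  obtain ⟨σ⟩ := exists_edgeOrientation G
  have h := σ.spectrum_eq hG
  rw [σ.isHermitian.spectrum_eq_image_range] at h
  have h' : {x : ℝ | G.matchingPoly.IsRoot x} = Set.range σ.isHermitian.eigenvalues :=
    (Complex.ofReal_injective.image_injective h).symm
  have hfin : {x : ℝ | G.matchingPoly.IsRoot x}.Finite := h' ▸ Set.finite_range _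
  have hne : {x : ℝ | G.matchingPoly.IsRoot x}.Nonempty := h' ▸ Set.range_nonempty _
  exact ⟨hne.csSup_mem hfin, fun x hx => le_csSup hfin.bddAbove hx⟩

theorem EdgeOrientation.radius_eq [Nonempty V] (σ : G.EdgeOrientation) (hG : G.IsOddCycleGraph) :
    σ.radius = G.maxMatchingRoot := by
  obtain ⟨hroot, hmax⟩ := hG.isGreatest_maxMatchingRoot
  have ht : 0 ≤ G.maxMatchingRoot := by
    have := hmax (isRoot_neg hroot)
    linarith
  have hmem : ∀ z : ℂ, z ∈ spectrum ℂ σ.skewMatrix ↔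
      Complex.I * z ∈ spectrum ℂ (Complex.I • σ.skewMatrix) := fun z =>
    (spectrum.smul_mem_smul_iff (r := Units.mk0 Complex.I Complex.I_ne_zero)).symm
  have : spectralRadius ℂ σ.skewMatrix = ENNReal.ofReal G.maxMatchingRoot := by
    apply le_antisymm
    · refine iSup₂_le fun z hz => ?_
      rw [hmem, σ.spectrum_eq hG] at hz
      obtain ⟨x, hx, he⟩ := hz
      have hz : ‖z‖ = |x| := by
        rw [← one_mul ‖z‖, ← Complex.norm_I, ← norm_mul, ← he, Complex.norm_real, Real.norm_eq_abs]
      rw [← enorm_eq_nnnorm, ← ofReal_norm, hz]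
      exact ENNReal.ofReal_le_ofReal (abs_le'.2 ⟨hmax hx, hmax (isRoot_neg hx)⟩)
    -- Multiplying by `i` sends this point to the largest root; the upper bound above used that the
    -- roots are symmetric about zero.
    · have hz : -Complex.I * G.maxMatchingRoot ∈ spectrum ℂ σ.skewMatrix := by
        rw [hmem, σ.spectrum_eq hG]
        refine ⟨_, hroot, ?_⟩
        rw [← mul_assoc, mul_neg, Complex.I_mul_I, neg_neg, one_mul]
      refine le_trans ?_ (le_iSup₂ (f := fun k (_ : k ∈ spectrum ℂ σ.skewMatrix) =>
        (‖k‖₊ : ENNReal)) _ hz)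
      rw [← enorm_eq_nnnorm, ← ofReal_norm, norm_mul, norm_neg, Complex.norm_I, one_mul, Complex.norm_real,
        Real.norm_of_nonneg ht]
  rw [radius, this, ENNReal.toReal_ofReal ht]

theorem IsOddCycleGraph.maxSkewRadius_eq [Nonempty V] (hG : G.IsOddCycleGraph) :
    G.maxSkewRadius = G.maxMatchingRoot := by
  have := exists_edgeOrientation G
  rw [maxSkewRadius, iSup_congr fun σ : G.EdgeOrientation => σ.radius_eq hG, ciSup_const]

end SimpleGraph

/-! ### Windmills: existence and uniqueness of the extremal graph. -/

namespace SimpleGraph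

open Classical

/-- The graph in which `v` is adjacent to all other vertices, and any further edges join the other
vertices to their images under `π`. -/
def windmill {V : Type*} (v : V) (π : Equiv.Perm V) : SimpleGraph V :=
  .fromRel fun a b => a = v ∨ π a = b

variable {V : Type*} {G : SimpleGraph V} {v : V} {π : Equiv.Perm V}

theorem windmill_adj (hπ : Function.Involutive (π : V → V)) {a b : V} :
    (windmill v π).Adj a b ↔ a ≠ b ∧ (a = v ∨ b = v ∨ π a = b) := by
  have : π b = a ↔ π a = b := ⟨fun h => by rw [← h, hπ], fun h => by rw [← h, hπ]⟩
  rw [windmill, fromRel_adj, this]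
  tauto

/-- Off the hub `v`, a step along an edge applies `π`, so two consecutive steps off `v` return to
the start. Hence a cycle passes through `v` and has length three. -/
theorem isOddCycleGraph_windmill (hπ : Function.Involutive (π : V → V)) :
    (windmill v π).IsOddCycleGraph := by
  have key : ∀ {u : V} (c : (windmill v π).Walk u u), ∀ i < c.length, c.getVert i ≠ v →
      c.getVert (i + 1) ≠ v → π (c.getVert i) = c.getVert (i + 1) := by
    intro u c i hi h1 h2
    have := ((windmill_adj hπ).1 (c.adj_getVert_succ hi)).2
    tauto
  intro u c hc
  by_cases hv : v ∈ c.support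
  · have hc' := hc.rotate hv
    rw [← c.length_rotate v hv]
    set c' := c.rotate v hv
    have h3 := hc'.three_le_length
    have hinj := hc'.getVert_injOn'
    have h0 : c'.getVert 0 = v := c'.getVert_zero
    have hne : ∀ i, 1 ≤ i → i ≤ c'.length - 1 → c'.getVert i ≠ v := fun i h1 h2 h => by
      have := hinj (show i ≤ c'.length - 1 from h2) (show 0 ≤ c'.length - 1 by lia) (h.trans h0.symm)
      lia
    rcases h3.eq_or_lt with h | h
    · rw [← h]; decide
    · exfalso
      have e1 := key c' 1 (by lia) (hne 1 (by lia) (by lia)) (hne 2 (by lia) (by lia))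
      have e2 := key c' 2 (by lia) (hne 2 (by lia) (by lia)) (hne 3 (by lia) (by lia))
      rw [← e1, hπ] at e2
      have := hinj (show 1 ≤ c'.length - 1 by lia) (show 3 ≤ c'.length - 1 by lia) e2
      lia
  · exfalso
    have h3 := hc.three_le_length
    have hne : ∀ i, c.getVert i ≠ v := fun i h => by
      have := c.getVert_mem_support i
      rw [h] at this
      exact hv this
    have e1 := key c 0 (by lia) (hne 0) (hne 1)
    have e2 := key c 1 (by lia) (hne 1) (hne 2)
    rw [← e1, hπ] at e2
    have := hc.getVert_injOn' (show 0 ≤ c.length - 1 by lia) (show 2 ≤ c.length - 1 by lia) e2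
    lia

variable [Fintype V]

theorem mem_edgeFinset_windmill_iff (hπ : Function.Involutive (π : V → V)) (hv : π v = v)
    (e : Sym2 V) : e ∈ (windmill v π).edgeSet ↔
      e ∈ (Finset.univ.erase v).image (fun w => s(v, w)) ∨ e ∈ orbitEdges π := by
  induction e with
  | h a b =>
    rw [mk_mem_orbitEdges hπ, mem_edgeSet, windmill_adj hπ]
    simp only [Finset.mem_image, Finset.mem_erase, Finset.mem_univ, and_true, Sym2.eq_iff]
    constructor
    · rintro ⟨hne, rfl | rfl | h⟩
      · exact .inl ⟨b, hne.symm, .inl ⟨rfl, rfl⟩⟩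
      · exact .inl ⟨a, hne, .inr ⟨rfl, rfl⟩⟩
      · exact .inr ⟨hne, h⟩
    · rintro (⟨w, hw, ⟨rfl, rfl⟩ | ⟨rfl, rfl⟩⟩ | ⟨hne, h⟩)
      · exact ⟨hw.symm, .inl rfl⟩
      · exact ⟨hw, .inr (.inl rfl)⟩
      · exact ⟨hne, .inr (.inr h)⟩

theorem card_edgeFinset_windmill (hπ : Function.Involutive (π : V → V)) (hv : π v = v) :
    (windmill v π).edgeFinset.card = Fintype.card V - 1 + (orbitEdges π).card := by
  have : (windmill v π).edgeFinset =
      (Finset.univ.erase v).image (fun w => s(v, w)) ∪ orbitEdges π := by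
    ext e
    rw [mem_edgeFinset, mem_edgeFinset_windmill_iff hπ hv, Finset.mem_union]
  rw [this, Finset.card_union_of_disjoint,
    Finset.card_image_of_injective _ fun a b h => Sym2.congr_right.1 h,
    Finset.card_erase_of_mem (Finset.mem_univ v), Finset.card_univ]
  rw [Finset.disjoint_left]
  intro e he he'
  obtain ⟨w, hw, rfl⟩ := Finset.mem_image.1 he
  obtain ⟨h1, h2⟩ := (mk_mem_orbitEdges hπ).1 he'
  exact h1 (hv.symm.trans h2)

/-- The isolated vertices are the fixed points of `π` other than `v`; their number is `n - 1` minus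
twice the number of blades. -/
theorem isFanOver_windmill_iff (hπ : Function.Involutive (π : V → V)) (hv : π v = v) :
    (windmill v π).IsFanOver v (Finset.univ.erase v) ↔
      (orbitEdges π).card = (Fintype.card V - 1) / 2 := by
  have h1 : (windmill v π).isolatedIn (Finset.univ.erase v) = (Finset.univ.erase v) \ π.support := by
    ext u
    simp only [mem_isolatedIn, Finset.mem_erase, Finset.mem_univ, and_true, Finset.mem_sdiff,
      Equiv.Perm.mem_support, not_not, windmill_adj hπ, not_and, not_or]
    refine and_congr_right fun hu => ⟨fun h => ?_, fun h w hw hne => ⟨hu, hw, by rwa [h]⟩⟩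
    by_contra hne
    have hπu : π u ≠ v := fun h' => hu (by rw [← hπ u, h', hv])
    exact (h (π u) hπu (Ne.symm hne)).2.2 rfl
  have hsub : π.support ⊆ Finset.univ.erase v := fun w hw => by
    refine Finset.mem_erase.2 ⟨?_, Finset.mem_univ w⟩
    rintro rfl
    exact Equiv.Perm.mem_support.1 hw hv
  have h2 : (Finset.univ.erase v : Finset V).card = Fintype.card V - 1 := by
    rw [Finset.card_erase_of_mem (Finset.mem_univ v), Finset.card_univ]
  have h3 := Finset.card_le_card hsub
  have h4 : ∀ z ∈ (Finset.univ.erase v : Finset V), (windmill v π).Adj v z := fun z hz =>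
    (windmill_adj hπ).2 ⟨(Finset.mem_erase.1 hz).1.symm, .inl rfl⟩
  have h5 := card_support_eq_two_mul hπ
  have h6 := Finset.card_sdiff_of_subset hsub
  rw [IsFanOver, and_iff_right h4]
  rw [h2, h5] at h3
  rw [h1, h6, h2, h5]
  lia

/-- The edges off `v` form a matching: a vertex with two neighbours `p`, `q` besides `v` would have
three neighbours in the connected set `{v, p, q}`. -/
theorem IsOddCycleGraph.exists_eq_windmill (hG : G.IsOddCycleGraph) (hv : ∀ z, z ≠ v → G.Adj v z) :
    ∃ π : Equiv.Perm V, Function.Involutive (π : V → V) ∧ π v = v ∧ G = windmill v π := by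
  have huniq : ∀ {u p q}, u ≠ v → p ≠ v → q ≠ v → G.Adj u p → G.Adj u q → p = q := by
    intro u p q hu hp hq hup huq
    by_contra hpq
    refine hG.not_three_neighbors (D := {v, p, q}) (a := u) (p := v) (q := p) (r := q) ?_
      (hv u hu).symm hup huq hp.symm hq.symm hpq
      (.of_adj (hv p hp) (by simp) (by simp)) (.of_adj (hv q hq) (by simp) (by simp))
    simp only [Finset.mem_insert, Finset.mem_singleton, not_or]
    exact ⟨hu, hup.ne, huq.ne⟩
  have hN : G.IsMatchingSet (G.edgeFinset.filter fun e => v ∉ e) := by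
    refine ⟨fun e he => by simpa using (Finset.mem_filter.1 he).1, fun e he f hf u hue huf => ?_⟩
    rw [Finset.mem_filter, mem_edgeFinset] at he hf
    obtain ⟨p, rfl⟩ := Sym2.mem_iff_exists.1 hue
    obtain ⟨q, rfl⟩ := Sym2.mem_iff_exists.1 huf
    simp only [Sym2.mem_iff, not_or, mem_edgeSet] at he hf
    rw [huniq (Ne.symm he.2.1) (Ne.symm he.2.2) (Ne.symm hf.2.2) he.1 hf.1]
  obtain ⟨π, hπ, -, hπN⟩ := hN.exists_involutive
  have hmem : ∀ a b, (a ≠ b ∧ π a = b) ↔ G.Adj a b ∧ v ≠ a ∧ v ≠ b := by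
    intro a b
    rw [← mk_mem_orbitEdges hπ, hπN, Finset.mem_filter, mem_edgeFinset, mem_edgeSet, Sym2.mem_iff,
      not_or]
  have hπv : π v = v := by
    by_contra h
    exact ((hmem v (π v)).1 ⟨Ne.symm h, rfl⟩).2.1 rfl
  refine ⟨π, hπ, hπv, ?_⟩
  ext a b
  rw [windmill_adj hπ]
  constructor
  · intro h
    refine ⟨h.ne, ?_⟩
    by_contra! hcon
    exact hcon.2.2 ((hmem a b).2 ⟨h, hcon.1.symm, hcon.2.1.symm⟩).2
  · rintro ⟨hne, rfl | rfl | h⟩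
    · exact hv b hne.symm
    · exact (hv a hne).symm
    · exact ((hmem a b).1 ⟨hne, h⟩).1

theorem IsExtremalOddCycleGraph.isFan (h : G.IsExtremalOddCycleGraph) : G.IsFan := by
  obtain ⟨v, hv⟩ := h.exists_degree
  have hadj : ∀ z, z ≠ v → G.Adj v z := by
    have hsub : G.neighborFinset v ⊆ Finset.univ.erase v := fun z hz => by
      rw [mem_neighborFinset] at hz
      simpa using hz.ne'
    have := Finset.eq_of_subset_of_card_le hsub (by
      rw [Finset.card_erase_of_mem (Finset.mem_univ v), Finset.card_univ, card_neighborFinset_eq_degree,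
        ← hv])
    intro z hz
    rw [← mem_neighborFinset, this]
    simpa using hz
  obtain ⟨π, hπ, hπv, rfl⟩ := h.isOddCycleGraph.exists_eq_windmill hadj
  refine ⟨v, (isFanOver_windmill_iff hπ hπv).2 ?_⟩
  have h1 := h.card_edges
  have h2 := card_edgeFinset_windmill hπ hπv
  rw [h2] at h1
  lia

theorem exists_isExtremalOddCycleGraph (V : Type*) [Fintype V] [Nonempty V] :
    ∃ H : SimpleGraph V, H.IsExtremalOddCycleGraph := by
  have hn : 0 < Fintype.card V := Fintype.card_pos
  set n := Fintype.card V with hnV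
  obtain ⟨π, hπ⟩ := (Equiv.Perm.exists_with_cycleType_iff V
    (m := Multiset.replicate ((n - 1) / 2) 2)).2 ⟨by simp; lia, fun a ha => by
      rw [Multiset.eq_of_mem_replicate ha]⟩
  have hsq : π ^ 2 = 1 := by
    rw [Equiv.Perm.pow_prime_eq_one_iff, hπ]
    exact fun c hc => Multiset.eq_of_mem_replicate hc
  have hinv : Function.Involutive (π : V → V) := fun w => by
    rw [← Equiv.Perm.mul_apply, ← sq, hsq, Equiv.Perm.one_apply]
  have hcard : π.support.card = 2 * ((n - 1) / 2) := by
    rw [← π.sum_cycleType, hπ]; simp [mul_comm]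
  -- With `(n - 1) / 2` transpositions at most `n - 1` vertices move, so a fixed point is left to
  -- serve as the hub.
  obtain ⟨v, hv⟩ : ∃ v, v ∉ π.support := by
    by_contra! h
    rw [Finset.eq_univ_iff_forall.2 h, Finset.card_univ] at hcard
    lia
  rw [Equiv.Perm.notMem_support] at hv
  have h2 := card_support_eq_two_mul hinv
  refine ⟨windmill v π, isOddCycleGraph_windmill hinv, ⟨v, ?_⟩, ?_⟩
  · rw [← card_neighborFinset_eq_degree]
    have : (windmill v π).neighborFinset v = Finset.univ.erase v := by
      ext z
      rw [mem_neighborFinset, windmill_adj hinv]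
      simp [eq_comm]
    rw [this, Finset.card_erase_of_mem (Finset.mem_univ v), Finset.card_univ]
  · rw [card_edgeFinset_windmill hinv hv, ← hnV]
    lia

theorem nonempty_windmill_iso {W : Type*} [Fintype W] {w : W} {ρ : Equiv.Perm W}
    (hπ : Function.Involutive (π : V → V)) (hρ : Function.Involutive (ρ : W → W)) (hπv : π v = v)
    (hρw : ρ w = w) (hcard : Fintype.card V = Fintype.card W)
    (h : (orbitEdges π).card = (orbitEdges ρ).card) :
    Nonempty (windmill v π ≃g windmill w ρ) := by
  obtain ⟨e⟩ := Fintype.card_eq.1 hcard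
  have hsq : ∀ {X : Type _} {τ : Equiv.Perm X}, Function.Involutive (τ : X → X) → τ ^ 2 = 1 := by
    intro X τ hτ
    ext x
    rw [sq, Equiv.Perm.mul_apply, hτ x, Equiv.Perm.one_apply]
  have hτ : Function.Involutive (e.permCongr π : W → W) := fun x => by simp [hπ _]
  have hsupp : (e.permCongr π).support = π.support.map e.toEmbedding := by
    ext x
    simp only [Equiv.Perm.mem_support, Equiv.permCongr_apply, Finset.mem_map_equiv, ne_eq,
      ← Equiv.eq_symm_apply]
  have hct : ∀ {τ : Equiv.Perm W}, Function.Involutive (τ : W → W) →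
      τ.cycleType = Multiset.replicate (τ.support.card / 2) 2 := by
    intro τ hτ
    have h1 := Equiv.Perm.cycleType_of_pow_prime_eq_one (p := 2) (hsq hτ)
    have h2 := τ.sum_cycleType
    rw [h1, Multiset.sum_replicate, smul_eq_mul] at h2
    rwa [← h2, Nat.mul_div_cancel _ two_pos]
  have hconj : IsConj (e.permCongr π) ρ := by
    rw [Equiv.Perm.isConj_iff_cycleType_eq, hct hτ, hct hρ, hsupp, Finset.card_map,
      card_support_eq_two_mul hπ, card_support_eq_two_mul hρ, h]
  obtain ⟨g, hg⟩ := isConj_iff.1 hconj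
  set f : V ≃ W := e.trans g with hf
  have hfπ : ∀ x, f (π x) = ρ (f x) := fun x => by
    rw [← hg]; simp [hf]
  have hfv : ρ (f v) = f v := by rw [← hfπ, hπv]
  -- A conjugation of the involutions need not match the hubs. Both `f v` and `w` are fixed by `ρ`,
  -- so swapping them commutes with `ρ` and corrects this.
  have hswap : ∀ x, Equiv.swap (f v) w (ρ x) = ρ (Equiv.swap (f v) w x) := by
    intro x
    have h1 : ρ x = f v ↔ x = f v := by
      conv_lhs => rw [← hfv]
      exact ρ.injective.eq_iff
    have h2 : ρ x = w ↔ x = w := by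
      conv_lhs => rw [← hρw]
      exact ρ.injective.eq_iff
    rw [Equiv.swap_apply_def, Equiv.swap_apply_def]
    simp only [h1, h2]
    split_ifs <;> simp [hfv, hρw]
  set F : V ≃ W := f.trans (Equiv.swap (f v) w) with hF
  have hFv : F v = w := by simp [hF]
  have hFπ : ∀ x, F (π x) = ρ (F x) := fun x => by
    change Equiv.swap (f v) w (f (π x)) = ρ (Equiv.swap (f v) w (f x))
    rw [hfπ, hswap]
  refine ⟨⟨F, ?_⟩⟩
  intro a b
  rw [windmill_adj hρ, windmill_adj hπ, ← hFv, ← hFπ]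
  simp only [ne_eq, F.injective.eq_iff]

theorem IsFan.exists_eq_windmill (hG : G.IsOddCycleGraph) (h : G.IsFan) :
    ∃ (v : V) (π : Equiv.Perm V), Function.Involutive (π : V → V) ∧ π v = v ∧
      (orbitEdges π).card = (Fintype.card V - 1) / 2 ∧ G = windmill v π := by
  obtain ⟨v, hv⟩ := h
  obtain ⟨π, hπ, hπv, rfl⟩ := hG.exists_eq_windmill fun z hz => hv.1 z (by simpa using hz)
  exact ⟨v, π, hπ, hπv, (isFanOver_windmill_iff hπ hπv).1 hv, rfl⟩

theorem IsFan.nonempty_iso {W : Type*} [Fintype W] {H : SimpleGraph W} (hG : G.IsOddCycleGraph)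
    (hH : H.IsOddCycleGraph) (h : G.IsFan) (h' : H.IsFan)
    (hcard : Fintype.card V = Fintype.card W) : Nonempty (G ≃g H) := by
  obtain ⟨v, π, hπ, hπv, hc, rfl⟩ := h.exists_eq_windmill hG
  obtain ⟨w, ρ, hρ, hρw, hc', rfl⟩ := h'.exists_eq_windmill hH
  exact nonempty_windmill_iso hπ hρ hπv hρw hcard (by rw [hc, hc', hcard])

theorem IsFan.of_iso {W : Type*} [Fintype W] {H : SimpleGraph W} (e : G ≃g H) (h : H.IsFan) :
    G.IsFan := by
  obtain ⟨w, hw, hcard⟩ := h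
  have hmem : ∀ z, z ∈ Finset.univ.erase (e.symm w) ↔ e z ∈ Finset.univ.erase w := fun z => by
    simp only [Finset.mem_erase, Finset.mem_univ, and_true, ne_eq, RelIso.eq_symm_apply]
  refine ⟨e.symm w, fun z hz => ?_, ?_⟩
  · rw [← e.map_adj_iff, e.apply_symm_apply]
    exact hw _ ((hmem z).1 hz)
  · have h1 : (Finset.univ.erase (e.symm w)).card = (Finset.univ.erase w).card :=
      Finset.card_equiv e.toEquiv hmem
    rw [h1, ← hcard]
    refine Finset.card_equiv e.toEquiv fun u => ?_
    rw [mem_isolatedIn, mem_isolatedIn, hmem]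
    refine and_congr_right fun _ => ⟨fun h x hx hadj => ?_, fun h x hx hadj => ?_⟩
    · refine h (e.symm x) ((hmem _).2 (by rwa [e.apply_symm_apply])) ?_
      rw [← e.map_adj_iff, e.apply_symm_apply]
      exact hadj
    · exact h (e x) ((hmem x).1 hx) (e.map_adj_iff.2 hadj)

theorem IsOddCycleGraph.maxMatchingRoot_le [Nonempty V] (hG : G.IsOddCycleGraph) :
    G.maxMatchingRoot ≤ extremalRoot (Fintype.card V) ∧
      (G.maxMatchingRoot = extremalRoot (Fintype.card V) ↔ G.IsFan) := by
  obtain ⟨hroot, hmax⟩ := hG.isGreatest_maxMatchingRoot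
  obtain ⟨hle, hiff⟩ := hG.root_le_extremalRoot
  refine ⟨hle _ hroot, fun h => ?_, fun h => le_antisymm (hle _ hroot) (hmax (hiff.2 h))⟩
  rw [← hiff, ← h]
  exact hroot

end SimpleGraph

theorem theorem4p2 (n : ℕ) (hn : 1 ≤ n) :
    ∃ H : SimpleGraph (Fin n), H.IsExtremalOddCycleGraph ∧
      ∀ (V : Type*) [Fintype V] (G : SimpleGraph V), Fintype.card V = n →
        -- `H` is unique up to isomorphism
        (G.IsExtremalOddCycleGraph → Nonempty (G ≃g H)) ∧
        (G.IsOddCycleGraph →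
          -- the maximum matching root exists, and it is maximal exactly for `H`
          IsGreatest {x : ℝ | G.matchingPoly.IsRoot x} G.maxMatchingRoot ∧
          G.maxMatchingRoot ≤ H.maxMatchingRoot ∧
          (G.maxMatchingRoot = H.maxMatchingRoot ↔ Nonempty (G ≃g H)) ∧
          -- it is the skew-spectral radius of every orientation, hence the maximum one
          (∀ σ : G.EdgeOrientation, σ.radius = G.maxMatchingRoot) ∧
          G.maxSkewRadius = G.maxMatchingRoot ∧
          G.maxSkewRadius ≤ H.maxSkewRadius ∧
          (G.maxSkewRadius = H.maxSkewRadius ↔ Nonempty (G ≃g H))) := by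
  have hneF : Nonempty (Fin n) := ⟨⟨0, hn⟩⟩
  obtain ⟨H, hH⟩ := SimpleGraph.exists_isExtremalOddCycleGraph (Fin n)
  refine ⟨H, hH, fun V _ G hV => ?_⟩
  have hne : Nonempty V := Fintype.card_pos_iff.1 (by lia)
  have hcard : Fintype.card V = Fintype.card (Fin n) := by rw [hV, Fintype.card_fin]
  have hHodd := hH.isOddCycleGraph
  refine ⟨fun hG => hG.isFan.nonempty_iso hG.isOddCycleGraph hHodd hH.isFan hcard, fun hG => ?_⟩
  obtain ⟨hle, hiff⟩ := hG.maxMatchingRoot_le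
  -- `H` is a fan and attains the extremal root, so that number may be replaced by the root of `H`.
  rw [hcard, ← hHodd.maxMatchingRoot_le.2.2 hH.isFan] at hle hiff
  have hiso : G.maxMatchingRoot = H.maxMatchingRoot ↔ Nonempty (G ≃g H) :=
    hiff.trans ⟨fun h => h.nonempty_iso hG hHodd hH.isFan hcard, fun ⟨e⟩ => hH.isFan.of_iso e⟩
  refine ⟨hG.isGreatest_maxMatchingRoot, hle, hiso, fun σ => σ.radius_eq hG, hG.maxSkewRadius_eq,
    ?_⟩
  rw [hG.maxSkewRadius_eq, hHodd.maxSkewRadius_eq]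
  exact ⟨hle, hiso⟩
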